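/- Let $d\in\mathbb N$, $d\ge 1$, $d<p\le\infty$ and $q:=\min\{p,2\}$. Let $W_p^1([0,1]^d)$ be the Sobolev space with norm $\|f\|=\bigl(\|f\|_{L_p}^p+\sum_{j=1}^d\|\partial_j f\|_{L_p}^p\bigr)^{1/p}$ (weak derivatives; maximum of the norms if $p=\infty$). Since $p>d$, each element is identified with its continuous representative on $[0,1]^d$. A method $A$ is called $(\varepsilon,\delta)$-approximating if $\mathbb P\{|A(f)-\int_{[0,1]^d}f\,dx|>\varepsilon\}\le\delta$ for all $f$ with $\|f\|\le1$, and $e(n,\delta):=e^{\mathrm{MC}}_{\mathrm{prob}}(n,\delta,W_p^1([0,1]^d))$ is the infimum of all $\varepsilon>0$ for which there is an $(\varepsilon,\delta)$-approximating randomized (possibly adaptive) algorithm that uses $n$ function values. For $m\in\mathbb N$, stratified sampling is the method $$S_m^d(f)=m^{-d}\sum_{\mathbf i\in\{0,\dots,m-1\}^d}f(\mathbf X_{\mathbf i}),$$ where the $\mathbf X_{\mathbf i}$ are independent and $\mathbf X_{\mathbf i}$ is uniformly distributed in $\prod_{j=1}^d[\tfrac{i_j}{m},\tfrac{i_j+1}{m})$.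 Put $$R(n,\delta):=n^{-1/d}\,\min\bigl\{1,\;n^{-(1-1/q)}\sqrt{\log\delta^{-1}}\bigr\}.$$ Then there are $n_0\in\mathbb N$, $\delta_0\in(0,1)$ and $c>0$, depending only on $d$ and $p$, such that for all $n\ge n_0$ and $\delta\in(0,\delta_0)$: 1. with $m:=\lfloor n^{1/d}\rfloor$, stratified sampling $S_m^d$ uses $m^d\le n$ function values and is $(c\,R(n,\delta),\delta)$-approximating; 2. consequently, $e(n,\delta)\le c\,R(n,\delta)$. If $p\ge2$, this upper bound is matched by a lower bound: there are $n_1\in\mathbb N$, $\delta_1\in(0,1)$ and $c'>0$, depending only on $d$ and $p$, with $R(n,\delta)\le c'\,e(n,\delta)$ for all $n\ge n_1$ and $\delta\in(0,\delta_1)$. -/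

import Mathlib

open MeasureTheory ProbabilityTheory Set
open scoped ENNReal

noncomputable section

namespace StratSampling

/-- The unit cube `[0,1]^d`. -/
def cube (d : ℕ) : Set (Fin d → ℝ) := Icc 0 1

/-- The integral `∫_{[0,1]^d} f(x) dx`. -/
def integralCube (d : ℕ) (f : (Fin d → ℝ) → ℝ) : ℝ := ∫ x in cube d, f x

/-! ### The Sobolev space of smoothness one on the cube -/

/-- `g = (g_1, …, g_d)` is the weak gradient of `f` on the open cube `(0,1)^d`. -/
def IsWeakGradient {d : ℕ} (f : (Fin d → ℝ) → ℝ) (g : Fin d → (Fin d → ℝ) → ℝ) : Prop :=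
  ∀ j, LocallyIntegrableOn (g j) (interior (cube d)) ∧
    ∀ φ : (Fin d → ℝ) → ℝ, ContDiff ℝ (⊤ : ℕ∞) φ → HasCompactSupport φ →
      tsupport φ ⊆ interior (cube d) →
      ∫ x in cube d, f x * fderiv ℝ φ x (Pi.single j 1) = - ∫ x in cube d, g j x * φ x

/-- The norm `(‖f‖_p^p + ∑_j ‖g_j‖_p^p)^{1/p}` (a maximum for `p = ∞`), with `L_p`-norms over the
cube; for `g` the weak gradient of `f` this is the `W_p^1`-norm of `f`. -/
def sobolevNorm {d : ℕ} (p : ℝ≥0∞) (f : (Fin d → ℝ) → ℝ) (g : Fin d → (Fin d → ℝ) → ℝ) : ℝ≥0∞ :=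
  if p = ∞ then
    max (eLpNorm f ∞ (volume.restrict (cube d)))
      (⨆ j, eLpNorm (g j) ∞ (volume.restrict (cube d)))
  else
    (eLpNorm f p (volume.restrict (cube d)) ^ p.toReal +
      ∑ j, eLpNorm (g j) p (volume.restrict (cube d)) ^ p.toReal) ^ (1 / p.toReal)

/-- The space `W_p^1([0,1]^d)` for `p > d`, whose elements are represented by their continuous
representatives, so that function values make sense. Values outside the cube are irrelevant. -/
def sobolevSpace (d : ℕ) (p : ℝ≥0∞) : Set ((Fin d → ℝ) → ℝ) :=
  {f | ContinuousOn f (cube d) ∧ ∃ g, IsWeakGradient f g ∧ sobolevNorm p f g < ∞}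

/-- The closed unit ball of `W_p^1([0,1]^d)`. The weak gradient is unique up to null sets, hence
the choice of `g` does not matter. -/
def sobolevBall (d : ℕ) (p : ℝ≥0∞) : Set ((Fin d → ℝ) → ℝ) :=
  {f | ContinuousOn f (cube d) ∧ ∃ g, IsWeakGradient f g ∧ sobolevNorm p f g ≤ 1}

/-! ### Monte Carlo algorithms and the probabilistic error -/

/-- The list of the first `k` function values of `f`, when the next sample point is `node y` with
`y` the list of the function values obtained so far. -/
def collect {d : ℕ} (node : List ℝ → cube d) (f : (Fin d → ℝ) → ℝ) : ℕ → List ℝ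
  | 0 => []
  | k + 1 => collect node f k ++ [f (node (collect node f k))]

/-- A (possibly adaptive) Monte Carlo algorithm using `n` function values, for integrands from the
class `W`: for each `ω` it collects `n` function values at the points determined by `node ω`, and
returns `output ω` of the list of these values. -/
structure MCAlgorithm (d n : ℕ) (W : Set ((Fin d → ℝ) → ℝ)) where
  Ω : Type
  [mΩ : MeasurableSpace Ω]
  P : Measure Ω
  [isProb : IsProbabilityMeasure P]
  node : Ω → List ℝ → cube d
  output : Ω → List ℝ → ℝ
  measurable_error : ∀ f ∈ W,
    Measurable fun ω => |output ω (collect (node ω) f n) - integralCube d f|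

attribute [instance] MCAlgorithm.mΩ MCAlgorithm.isProb

/-- The output of a Monte Carlo algorithm for the realization `ω` and the input `f`. -/
def MCAlgorithm.run {d n : ℕ} {W : Set ((Fin d → ℝ) → ℝ)} (A : MCAlgorithm d n W) (ω : A.Ω)
    (f : (Fin d → ℝ) → ℝ) : ℝ :=
  A.output ω (collect (A.node ω) f n)

/-- A randomized method `A` on the probability space `(Ω, P)` is `(ε,δ)`-approximating for the
inputs `f ∈ B`. -/
def IsApproximating {d : ℕ} {Ω : Type*} [MeasurableSpace Ω] (P : Measure Ω)
    (A : Ω → ((Fin d → ℝ) → ℝ) → ℝ) (B : Set ((Fin d → ℝ) → ℝ)) (ε δ : ℝ) : Prop :=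
  ∀ f ∈ B, P {ω | ε < |A ω f - integralCube d f|} ≤ ENNReal.ofReal δ

/-- The `n`-th minimal probabilistic Monte Carlo error at uncertainty `δ` on `W_p^1([0,1]^d)`: the
infimum of all `ε > 0` such that some `(ε,δ)`-approximating algorithm uses `n` function values. -/
def eProb (d : ℕ) (p : ℝ≥0∞) (n : ℕ) (δ : ℝ) : ℝ≥0∞ :=
  ⨅ (ε : ℝ) (_ : 0 < ε ∧ ∃ A : MCAlgorithm d n (sobolevSpace d p),
    IsApproximating A.P A.run (sobolevBall d p) ε δ), ENNReal.ofReal ε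

/-! ### Stratified sampling -/

/-- The subcube `∏_j [i_j/m, (i_j+1)/m)`. -/
def subcube {d m : ℕ} (i : Fin d → Fin m) : Set (Fin d → ℝ) :=
  {x | ∀ j, ((i j : ℕ) : ℝ) / m ≤ x j ∧ x j < (((i j : ℕ) : ℝ) + 1) / m}

/-- The random points `X_i` are independent, each uniformly distributed in its subcube. -/
def IsStratifiedSample {d m : ℕ} {Ω : Type*} [MeasurableSpace Ω] (P : Measure Ω)
    (X : (Fin d → Fin m) → Ω → (Fin d → ℝ)) : Prop :=
  (∀ i, Measurable (X i)) ∧ iIndepFun X P ∧ ∀ i, pdf.IsUniform (X i) (subcube i) P volume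

/-- Stratified sampling `S_m^d(f) = m^{-d} ∑_i f(X_i)`. -/
def stratified {d m : ℕ} {Ω : Type*} (X : (Fin d → Fin m) → Ω → (Fin d → ℝ)) (ω : Ω)
    (f : (Fin d → ℝ) → ℝ) : ℝ :=
  1 / (m : ℝ) ^ d * ∑ i, f (X i ω)

/-- The number `m = ⌊n^{1/d}⌋` of subdivisions per coordinate for the information budget `n`. -/
def gridSize (d n : ℕ) : ℕ := ⌊(n : ℝ) ^ (1 / (d : ℝ))⌋₊

/-! ### Rates -/

/-- `n^{-1/d} min{1, n^{-(1-1/q)} √(log δ⁻¹)}` -/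
def rate (d : ℕ) (q : ℝ) (n : ℕ) (δ : ℝ) : ℝ :=
  (n : ℝ) ^ (-(1 / (d : ℝ))) * min 1 ((n : ℝ) ^ (-(1 - 1 / q)) * √(Real.log δ⁻¹))

/-- `Q c n δ` holds for some constant `c > 0`, all large `n` and all small `δ > 0`. -/
def ForSomeConstEventually (Q : ℝ → ℕ → ℝ → Prop) : Prop :=
  ∃ n₀ : ℕ, ∃ δ₀ ∈ Ioo (0 : ℝ) 1, ∃ c : ℝ, 0 < c ∧
    ∀ n : ℕ, n₀ ≤ n → ∀ δ ∈ Ioo (0 : ℝ) δ₀, Q c n δ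

/-- The relation `e(n,δ) ⪯ f(n,δ)`. -/
def AsympLE (e f : ℕ → ℝ → ℝ≥0∞) : Prop :=
  ForSomeConstEventually fun c n δ => e n δ ≤ ENNReal.ofReal c * f n δ

end StratSampling
end

/-!
Upper bound. Contract the cube towards one of its points `x` and follow a smooth averaging weight
under these homotheties: as the ratio decreases from one to zero, the weighted mean of `f` moves
continuously to `f x`. The moving weight solves a continuity equation whose flux is compactly
supported inside the cube, so it is an admissible family of test functions, and the difference
between `f x` and the mean becomes an integral of the weak gradient against the flux. Hölder's
inequality makes this integral finite as soon as `p > d`. On the cubes of side `1 / m` this bounds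
the oscillation of `f` by `m⁻¹` times a sequence whose `p`-th powers have bounded mean, and
Hoeffding's inequality applied to the independent summands of stratified sampling gives the rate.

Lower bound. Put bumps on `k ^ d ≥ 2 n` subcubes and give them random signs. The integral is then a
multiple of a sum of random signs, and the Paley–Zygmund inequality applied to an exponentially
tilted sum shows that this sum is not concentrated. An algorithm sees at most `n` of the signs, and
re-randomizing the unseen ones leaves its output unchanged but moves the integral.
-/

namespace StratSampling

/-! ### The unit cube -/

lemma mem_cube {d : ℕ} {x : Fin d → ℝ} : x ∈ cube d ↔ ∀ j, 0 ≤ x j ∧ x j ≤ 1 := by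
  simp only [cube, mem_Icc, Pi.le_def, Pi.zero_apply, Pi.one_apply, forall_and]

lemma isCompact_cube (d : ℕ) : IsCompact (cube d) := isCompact_Icc

lemma measurableSet_cube (d : ℕ) : MeasurableSet (cube d) := measurableSet_Icc

lemma convex_cube (d : ℕ) : Convex ℝ (cube d) := convex_Icc 0 1

lemma volume_cube (d : ℕ) : volume (cube d) = 1 := by
  simp [cube, Real.volume_Icc_pi]

instance isProbabilityMeasure_restrict_cube (d : ℕ) :
    IsProbabilityMeasure (volume.restrict (cube d)) :=
  ⟨by simp [volume_cube]⟩

lemma volume_restrict_interior_cube (d : ℕ) :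
    volume.restrict (interior (cube d)) = volume.restrict (cube d) :=
  Measure.restrict_congr_set
    (interior_ae_eq_of_null_frontier ((convex_cube d).addHaar_frontier volume))

lemma IsWeakGradient.aestronglyMeasurable {d : ℕ} {f : (Fin d → ℝ) → ℝ}
    {g : Fin d → (Fin d → ℝ) → ℝ} (hg : IsWeakGradient f g) (j : Fin d) :
    AEStronglyMeasurable (g j) (volume.restrict (cube d)) := by
  rw [← volume_restrict_interior_cube]
  exact (hg j).1.aestronglyMeasurable

/-! ### Morrey's inequality -/

section Morrey

variable {d : ℕ}

/-- The density of the push-forward of the density `ψ` under the homothety `u ↦ x + s • (u - x)`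
with centre `x` and ratio `s`. As `s` runs from `1` to `0`, the mass moves from `ψ` to a multiple
of the Dirac measure at `x`. -/
noncomputable def dilation (ψ : (Fin d → ℝ) → ℝ) (x : Fin d → ℝ) (s : ℝ) (y : Fin d → ℝ) : ℝ :=
  s⁻¹ ^ d * ψ (x + s⁻¹ • (y - x))

/-- The derivative of `dilation ψ x s y` with respect to the ratio `s`. -/
noncomputable def dilationDeriv (ψ : (Fin d → ℝ) → ℝ) (x : Fin d → ℝ) (s : ℝ)
    (y : Fin d → ℝ) : ℝ :=
  -(s⁻¹ * s⁻¹ ^ d * (d * ψ (x + s⁻¹ • (y - x)) +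
    fderiv ℝ ψ (x + s⁻¹ • (y - x)) (s⁻¹ • (y - x))))

/-- The `j`-th component of the flux of mass of `dilation ψ x s` as `s` varies: the density times
the velocity `(y - x) / s` of the homotheties. -/
noncomputable def dilationFlux (ψ : (Fin d → ℝ) → ℝ) (x : Fin d → ℝ) (s : ℝ) (j : Fin d)
    (y : Fin d → ℝ) : ℝ :=
  (y j - x j) * s⁻¹ * dilation ψ x s y

variable {ψ f : (Fin d → ℝ) → ℝ} {g : Fin d → (Fin d → ℝ) → ℝ} {x y : Fin d → ℝ} {s : ℝ}

lemma continuous_dilation (hψ : Continuous ψ) : Continuous (dilation ψ x s) := by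
  unfold dilation
  fun_prop

lemma contDiff_dilationFlux {n : WithTop ℕ∞} (hψ : ContDiff ℝ n ψ) (j : Fin d) :
    ContDiff ℝ n (dilationFlux ψ x s j) := by
  unfold dilationFlux dilation
  fun_prop

lemma hasDerivAt_dilation (hψ : Differentiable ℝ ψ) (hs : s ≠ 0) :
    HasDerivAt (fun s => dilation ψ x s y) (dilationDeriv ψ x s y) s := by
  have hexpand : HasDerivAt (fun s : ℝ => x + s⁻¹ • (y - x)) ((-(s ^ 2)⁻¹) • (y - x)) s :=
    ((hasDerivAt_inv hs).smul_const (y - x)).const_add x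
  have hjacobian : HasDerivAt (fun s : ℝ => s⁻¹ ^ d) (-(d * s⁻¹ * s⁻¹ ^ d)) s := by
    refine ((hasDerivAt_inv hs).pow d).congr_deriv ?_
    rcases d with _ | d
    · simp
    · simp only [Nat.add_sub_cancel, pow_succ]
      field_simp
  refine (hjacobian.mul
    ((hψ (x + s⁻¹ • (y - x))).hasFDerivAt.comp_hasDerivAt s hexpand)).congr_deriv ?_
  simp only [dilationDeriv, map_smul, smul_eq_mul, Function.comp]
  field_simp
  ring

lemma fderiv_dilationFlux (hψ : Differentiable ℝ ψ) (j : Fin d) :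
    fderiv ℝ (dilationFlux ψ x s j) y (Pi.single j 1) =
      s⁻¹ * s⁻¹ ^ d * (ψ (x + s⁻¹ • (y - x)) +
        fderiv ℝ ψ (x + s⁻¹ • (y - x)) (s⁻¹ • (y j - x j) • Pi.single j 1)) := by
  have hexpand : HasFDerivAt (fun y : Fin d → ℝ => x + s⁻¹ • (y - x))
      (s⁻¹ • ContinuousLinearMap.id ℝ (Fin d → ℝ)) y :=
    (((hasFDerivAt_id y).sub_const x).const_smul s⁻¹).const_add x
  have hvelocity : HasFDerivAt (fun y : Fin d → ℝ => (y j - x j) * s⁻¹)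
      (s⁻¹ • ContinuousLinearMap.proj (R := ℝ) (φ := fun _ : Fin d => ℝ) j) y :=
    (((ContinuousLinearMap.proj (R := ℝ) (φ := fun _ : Fin d => ℝ) j).hasFDerivAt).sub_const
      (x j)).mul_const s⁻¹
  have hflux : fderiv ℝ (dilationFlux ψ x s j) y = _ :=
    (hvelocity.mul (((hψ (x + s⁻¹ • (y - x))).hasFDerivAt.comp y hexpand).const_mul
      (s⁻¹ ^ d))).fderiv
  rw [hflux]
  simp only [add_apply, FunLike.coe_smul, Pi.smul_apply,
    ContinuousLinearMap.proj_apply, ContinuousLinearMap.comp_apply, ContinuousLinearMap.id_apply,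
    smul_eq_mul, Pi.single_eq_same, map_smul, Function.comp]
  ring

/-- The continuity equation of the moving mass. -/
lemma dilationDeriv_eq_neg_sum_fderiv_dilationFlux (hψ : Differentiable ℝ ψ) :
    dilationDeriv ψ x s y = -∑ j, fderiv ℝ (dilationFlux ψ x s j) y (Pi.single j 1) := by
  have hsum : ∑ j, (y j - x j) • (Pi.single j 1 : Fin d → ℝ) = y - x := by
    ext i
    simp [Finset.sum_apply, Pi.single_apply]
  simp_rw [fderiv_dilationFlux hψ, dilationDeriv]
  rw [← Finset.mul_sum, Finset.sum_add_distrib, ← map_sum, ← Finset.smul_sum, hsum]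
  simp

lemma continuousOn_dilationDeriv (hψ : ContDiff ℝ 1 ψ) :
    ContinuousOn (fun z : ℝ × (Fin d → ℝ) => dilationDeriv ψ x z.1 z.2) {z | z.1 ≠ 0} := by
  have hinv : ContinuousOn (fun z : ℝ × (Fin d → ℝ) => z.1⁻¹) {z | z.1 ≠ 0} :=
    continuousOn_fst.inv₀ fun z hz => hz
  have hsmul : ContinuousOn (fun z : ℝ × (Fin d → ℝ) => z.1⁻¹ • (z.2 - x)) {z | z.1 ≠ 0} :=
    hinv.smul (continuousOn_snd.sub continuousOn_const)
  have hexpand := continuousOn_const (c := x).add hsmul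
  exact ((hinv.mul (hinv.pow d)).mul
    ((continuousOn_const.mul (hψ.continuous.comp_continuousOn hexpand)).add
      (((hψ.continuous_fderiv one_ne_zero).comp_continuousOn hexpand).clm_apply hsmul))).neg

lemma add_smul_expand (hs : s ≠ 0) : x + s • (x + s⁻¹ • (y - x) - x) = y := by
  rw [add_sub_cancel_left, smul_inv_smul₀ hs, add_sub_cancel]

lemma mem_of_expand_mem {Q : Set (Fin d → ℝ)} (hQ : Convex ℝ Q) (hx : x ∈ Q)
    (hs : s ∈ Ioo (0 : ℝ) 1) (hy : x + s⁻¹ • (y - x) ∈ Q) : y ∈ Q :=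
  add_smul_expand (x := x) (y := y) hs.1.ne' ▸ hQ.add_smul_sub_mem hx hy ⟨hs.1.le, hs.2.le⟩

lemma mem_interior_of_expand_mem_interior {Q : Set (Fin d → ℝ)} (hQ : Convex ℝ Q) (hx : x ∈ Q)
    (hs : s ∈ Ioo (0 : ℝ) 1) (hy : x + s⁻¹ • (y - x) ∈ interior Q) : y ∈ interior Q :=
  add_smul_expand (x := x) (y := y) hs.1.ne' ▸ hQ.add_smul_sub_mem_interior hx hy ⟨hs.1, hs.2.le⟩

lemma tsupport_dilationFlux_subset {Q : Set (Fin d → ℝ)} (hQ : Convex ℝ Q)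
    (hψ : tsupport ψ ⊆ interior Q) (hx : x ∈ Q) (hs : s ∈ Ioo (0 : ℝ) 1) (j : Fin d) :
    tsupport (dilationFlux ψ x s j) ⊆ interior Q := by
  intro y hy
  have hy' : y ∈ tsupport (ψ ∘ fun y => x + s⁻¹ • (y - x)) :=
    tsupport_mul_subset_right (tsupport_mul_subset_right hy)
  exact mem_interior_of_expand_mem_interior hQ hx hs
    (hψ (tsupport_comp_subset_preimage ψ (f := fun y => x + s⁻¹ • (y - x)) (by fun_prop) hy'))

lemma hasDerivAt_integral_mul_dilation {K : Set (Fin d → ℝ)} (hK : IsCompact K)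
    (hf : Continuous f) (hψ : ContDiff ℝ 1 ψ) (hs : 0 < s) :
    HasDerivAt (fun s => ∫ y in K, f y * dilation ψ x s y)
      (∫ y in K, f y * dilationDeriv ψ x s y) s := by
  have hcont : ContinuousOn (fun z : ℝ × (Fin d → ℝ) => f z.2 * dilationDeriv ψ x z.1 z.2)
      {z | z.1 ≠ 0} :=
    (hf.comp continuous_snd).continuousOn.mul (continuousOn_dilationDeriv hψ)
  obtain ⟨C, hC⟩ := ((isCompact_Icc (a := s / 2) (b := 2 * s)).prod hK).exists_bound_of_continuousOn
    (hcont.mono fun z hz => ((half_pos hs).trans_le hz.1.1).ne')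
  have : IsFiniteMeasure (volume.restrict K) := ⟨by simpa using hK.measure_lt_top⟩
  have hcont_s : Continuous fun y => f y * dilationDeriv ψ x s y :=
    continuousOn_univ.1 (hcont.comp (f := fun y => (s, y)) (by fun_prop) fun y _ => hs.ne')
  refine (hasDerivAt_integral_of_dominated_loc_of_deriv_le (bound := fun _ => C)
    (F' := fun s y => f y * dilationDeriv ψ x s y)
    (Ioo_mem_nhds (half_lt_self hs) (lt_two_mul_self hs))
    (Filter.Eventually.of_forall fun t =>
      (hf.mul (continuous_dilation hψ.continuous)).aestronglyMeasurable)
    ((hf.mul (continuous_dilation hψ.continuous)).continuousOn.integrableOn_compact hK)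
    hcont_s.aestronglyMeasurable ?_ (integrable_const C) ?_).2
  · filter_upwards [ae_restrict_mem hK.measurableSet] with y hy t ht
    exact hC (t, y) ⟨⟨ht.1.le, ht.2.le⟩, hy⟩
  · exact Filter.Eventually.of_forall fun y t ht =>
      (hasDerivAt_dilation (hψ.differentiable one_ne_zero)
        ((half_pos hs).trans ht.1).ne').const_mul (f y)

lemma integral_mul_dilationDeriv (hf : Continuous f) (hg : IsWeakGradient f g)
    (hψ : ContDiff ℝ (⊤ : ℕ∞) ψ) (hψs : tsupport ψ ⊆ interior (cube d)) (hx : x ∈ cube d)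
    (hs : s ∈ Ioo (0 : ℝ) 1) :
    ∫ y in cube d, f y * dilationDeriv ψ x s y =
      ∑ j, ∫ y in cube d, g j y * dilationFlux ψ x s j y := by
  have hflux (j) : tsupport (dilationFlux ψ x s j) ⊆ interior (cube d) :=
    tsupport_dilationFlux_subset (convex_cube d) hψs hx hs j
  have hcompact (j) : HasCompactSupport (dilationFlux ψ x s j) :=
    (isCompact_cube d).of_isClosed_subset (isClosed_tsupport _) ((hflux j).trans interior_subset)
  have hweak (j) := (hg j).2 _ (contDiff_dilationFlux hψ j) (hcompact j) (hflux j)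
  have hintegrable (j) : IntegrableOn
      (fun y => f y * fderiv ℝ (dilationFlux ψ x s j) y (Pi.single j 1)) (cube d) := by
    have hcont : Continuous fun y => fderiv ℝ (dilationFlux ψ x s j) y (Pi.single j 1) :=
      ((contDiff_dilationFlux hψ j).continuous_fderiv (by simp)).clm_apply continuous_const
    exact (hf.mul hcont).continuousOn.integrableOn_compact (isCompact_cube d)
  simp_rw [dilationDeriv_eq_neg_sum_fderiv_dilationFlux (hψ.differentiable (by simp)), mul_neg,
    Finset.mul_sum]
  rw [integral_neg, integral_finsetSum _ fun j _ => hintegrable j]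
  simp_rw [hweak, Finset.sum_neg_distrib, neg_neg]

lemma integral_mul_comp_homothety (hs : 0 < s) :
    ∫ u, ψ u * f (x + s • (u - x)) = ∫ y, f y * dilation ψ x s y := by
  have hshift : ∫ u, ψ u * f (x + s • (u - x)) = ∫ v, ψ (x + v) * f (x + s • v) := by
    rw [← integral_add_left_eq_self _ x]
    simp only [add_sub_cancel_left]
  have hscale : ∫ v, ψ (x + v) * f (x + s • v) =
      ∫ w, s⁻¹ ^ d * (ψ (x + s⁻¹ • w) * f (x + w)) := by
    have h := Measure.integral_comp_smul (volume : Measure (Fin d → ℝ))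
      (fun w => ψ (x + s⁻¹ • w) * f (x + w)) s
    simp only [inv_smul_smul₀ hs.ne', Module.finrank_fin_fun, smul_eq_mul] at h
    rw [h, abs_of_pos (by positivity), ← inv_pow, integral_const_mul]
  rw [hshift, hscale, ← integral_add_left_eq_self (fun y => f y * dilation ψ x s y) x]
  simp only [dilation, add_sub_cancel_left]
  congr with w
  ring

lemma eq_zero_of_tsupport_subset_interior {Q : Set (Fin d → ℝ)} (hψ : tsupport ψ ⊆ interior Q)
    {u : Fin d → ℝ} (hu : u ∉ Q) : ψ u = 0 :=
  image_eq_zero_of_notMem_tsupport fun h => hu (interior_subset (hψ h))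

lemma hasDerivAt_integral_mul_comp_homothety (hf : Continuous f) (hg : IsWeakGradient f g)
    (hψ : ContDiff ℝ (⊤ : ℕ∞) ψ) (hψs : tsupport ψ ⊆ interior (cube d)) (hx : x ∈ cube d)
    (hs : s ∈ Ioo (0 : ℝ) 1) :
    HasDerivAt (fun s => ∫ u in cube d, ψ u * f (x + s • (u - x)))
      (∑ j, ∫ y in cube d, g j y * dilationFlux ψ x s j y) s := by
  rw [← integral_mul_dilationDeriv hf hg hψ hψs hx hs]
  refine (hasDerivAt_integral_mul_dilation (isCompact_cube d) hf (hψ.of_le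
    (by exact_mod_cast le_top)) hs.1).congr_of_eventuallyEq ?_
  filter_upwards [Ioo_mem_nhds hs.1 hs.2] with t ht
  rw [setIntegral_eq_integral_of_forall_compl_eq_zero, integral_mul_comp_homothety ht.1,
    setIntegral_eq_integral_of_forall_compl_eq_zero]
  · intro y hy
    rw [dilation, eq_zero_of_tsupport_subset_interior hψs
      (mt (mem_of_expand_mem (convex_cube d) hx ht) hy), mul_zero, mul_zero]
  · intro u hu
    rw [eq_zero_of_tsupport_subset_interior hψs hu, zero_mul]

lemma volume_preimage_expand (hs : 0 < s) (Q : Set (Fin d → ℝ)) :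
    volume ((fun y => x + s⁻¹ • (y - x)) ⁻¹' Q) = ENNReal.ofReal (s ^ d) * volume Q := by
  have hpre : (fun y => x + s⁻¹ • (y - x)) ⁻¹' Q = AffineMap.homothety x s '' Q := by
    ext y
    simp only [mem_preimage, mem_image, AffineMap.homothety_apply, vsub_eq_sub, vadd_eq_add]
    constructor
    · exact fun hy => ⟨_, hy, by rw [add_comm, add_smul_expand hs.ne']⟩
    · rintro ⟨u, hu, rfl⟩
      rwa [add_sub_cancel_right, inv_smul_smul₀ hs.ne', add_sub_cancel]
  rw [hpre, Measure.addHaar_image_homothety, Module.finrank_fin_fun, abs_of_pos (pow_pos hs d)]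

lemma abs_dilationFlux_le (hψ : ∀ u, ψ u ∈ Icc (0 : ℝ) 1) {h : ℝ} {j : Fin d} (hs : 0 < s)
    (hy : |(x + s⁻¹ • (y - x)) j - x j| ≤ h) : |dilationFlux ψ x s j y| ≤ h * s⁻¹ ^ d := by
  obtain ⟨hψ0, hψ1⟩ := hψ (x + s⁻¹ • (y - x))
  have hvelocity : |(y j - x j) * s⁻¹| ≤ h := by
    simpa [mul_comm] using hy
  have hpow : 0 ≤ s⁻¹ ^ d := by positivity
  rw [dilationFlux, dilation, abs_mul, abs_of_nonneg (mul_nonneg hpow hψ0)]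
  exact mul_le_mul hvelocity (mul_le_of_le_one_right hpow hψ1) (mul_nonneg hpow hψ0)
    ((abs_nonneg _).trans hvelocity)

lemma eLpNorm_one_restrict_le {E : Type*} [MeasurableSpace E] {μ : Measure E} {T Q : Set E}
    {v : E → ℝ} (hv : AEStronglyMeasurable v (μ.restrict Q)) (hTQ : T ⊆ Q) {p : ℝ} (hp : 1 ≤ p) :
    eLpNorm v 1 (μ.restrict T) ≤
      eLpNorm v (ENNReal.ofReal p) (μ.restrict Q) * μ T ^ (1 - 1 / p) := by
  have hmono := Measure.restrict_mono hTQ (le_refl μ)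
  have hholder := eLpNorm_le_eLpNorm_mul_rpow_measure_univ (p := 1) (q := ENNReal.ofReal p)
    (by simpa using hp) (hv.mono_measure hmono)
  simp only [Measure.restrict_apply_univ, ENNReal.toReal_one,
    ENNReal.toReal_ofReal (zero_le_one.trans hp), div_one] at hholder
  exact hholder.trans (mul_le_mul_left (eLpNorm_mono_measure v hmono) _)

lemma enorm_integral_mul_dilationFlux_le {v : (Fin d → ℝ) → ℝ} {Q : Set (Fin d → ℝ)}
    (hv : AEStronglyMeasurable v (volume.restrict Q)) (hQ : Convex ℝ Q) (hQm : MeasurableSet Q)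
    (hQcube : Q ⊆ cube d) (hψ : ∀ u, ψ u ∈ Icc (0 : ℝ) 1) (hψQ : ∀ u ∉ Q, ψ u = 0)
    {p : ℝ} (hp : 1 ≤ p) (hx : x ∈ Q) {h : ℝ} {j : Fin d} (hh : ∀ u ∈ Q, |u j - x j| ≤ h)
    (hs : s ∈ Ioo (0 : ℝ) 1) :
    ‖∫ y in cube d, v y * dilationFlux ψ x s j y‖ₑ ≤
      ENNReal.ofReal (h * s⁻¹ ^ d) * (eLpNorm v (ENNReal.ofReal p) (volume.restrict Q) *
        (ENNReal.ofReal (s ^ d) * volume Q) ^ (1 - 1 / p)) := by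
  set T : Set (Fin d → ℝ) := (fun y => x + s⁻¹ • (y - x)) ⁻¹' Q
  have hTQ : T ⊆ Q := fun y => mem_of_expand_mem hQ hx hs
  have hTm : MeasurableSet T := measurableSet_preimage (by fun_prop) hQm
  have hpointwise (y) : ‖v y * dilationFlux ψ x s j y‖ₑ ≤
      T.indicator (fun y => ENNReal.ofReal (h * s⁻¹ ^ d) * ‖v y‖ₑ) y := by
    by_cases hy : y ∈ T
    · rw [indicator_of_mem hy, enorm_mul, mul_comm, Real.enorm_eq_ofReal_abs (dilationFlux ..)]
      gcongr
      exact abs_dilationFlux_le hψ hs.1 (hh _ hy)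
    · simp [dilationFlux, dilation, hψQ _ hy]
  calc ‖∫ y in cube d, v y * dilationFlux ψ x s j y‖ₑ
      ≤ ∫⁻ y in cube d, ‖v y * dilationFlux ψ x s j y‖ₑ := enorm_integral_le_lintegral_enorm _
    _ ≤ ∫⁻ y in cube d, T.indicator (fun y => ENNReal.ofReal (h * s⁻¹ ^ d) * ‖v y‖ₑ) y :=
        lintegral_mono hpointwise
    _ = ENNReal.ofReal (h * s⁻¹ ^ d) * eLpNorm v 1 (volume.restrict T) := by
        rw [lintegral_indicator hTm, Measure.restrict_restrict hTm,
          inter_eq_self_of_subset_left (hTQ.trans hQcube),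
          lintegral_const_mul' _ _ ENNReal.ofReal_ne_top, eLpNorm_one_eq_lintegral_enorm]
    _ ≤ _ := by
        rw [← volume_preimage_expand (x := x) hs.1]
        gcongr
        exact eLpNorm_one_restrict_le hv hTQ hp

lemma abs_integral_mul_dilationFlux_le {v : (Fin d → ℝ) → ℝ} {Q : Set (Fin d → ℝ)}
    (hv : AEStronglyMeasurable v (volume.restrict Q)) (hQ : Convex ℝ Q) (hQm : MeasurableSet Q)
    (hQcube : Q ⊆ cube d) (hψ : ∀ u, ψ u ∈ Icc (0 : ℝ) 1) (hψQ : ∀ u ∉ Q, ψ u = 0)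
    {p : ℝ} (hp : 1 ≤ p) (hvp : eLpNorm v (ENNReal.ofReal p) (volume.restrict Q) ≠ ∞)
    (hx : x ∈ Q) {h : ℝ} {j : Fin d} (hh : ∀ u ∈ Q, |u j - x j| ≤ h) (hs : s ∈ Ioo (0 : ℝ) 1) :
    |∫ y in cube d, v y * dilationFlux ψ x s j y| ≤
      h * volume.real Q ^ (1 - 1 / p) *
        (eLpNorm v (ENNReal.ofReal p) (volume.restrict Q)).toReal * s ^ (-(d / p)) := by
  have hs0 := hs.1
  have hh0 : 0 ≤ h := (abs_nonneg _).trans (hh x hx)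
  have hexp : 0 ≤ 1 - 1 / p := sub_nonneg.2 ((div_le_one (by linarith)).2 hp)
  have hQfin : volume Q ≠ ∞ := measure_ne_top_of_subset hQcube (isCompact_cube d).measure_ne_top
  have hrhs : ENNReal.ofReal (h * s⁻¹ ^ d) * (eLpNorm v (ENNReal.ofReal p) (volume.restrict Q) *
      (ENNReal.ofReal (s ^ d) * volume Q) ^ (1 - 1 / p)) ≠ ∞ := by finiteness
  have hle := ENNReal.toReal_mono hrhs
    (enorm_integral_mul_dilationFlux_le hv hQ hQm hQcube hψ hψQ hp hx hh hs)
  rw [toReal_enorm, Real.norm_eq_abs, ENNReal.toReal_mul, ENNReal.toReal_mul,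
    ← ENNReal.toReal_rpow, ENNReal.toReal_mul, ENNReal.toReal_ofReal (by positivity),
    ENNReal.toReal_ofReal (by positivity), ← measureReal_def,
    Real.mul_rpow (by positivity) measureReal_nonneg] at hle
  have hpow : s⁻¹ ^ d * (s ^ d) ^ (1 - 1 / p) = s ^ (-(d / p)) := by
    rw [← Real.rpow_natCast, ← Real.rpow_natCast, ← Real.rpow_mul hs0.le, Real.inv_rpow hs0.le,
      ← Real.rpow_neg hs0.le, ← Real.rpow_add hs0]
    congr 1
    ring
  rw [← hpow]
  exact hle.trans_eq (by ring)

lemma abs_sub_le_sub_of_abs_deriv_le {F F' G G' : ℝ → ℝ} {a b : ℝ} (hab : a ≤ b)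
    (hF : ContinuousOn F (Icc a b)) (hF' : ∀ s ∈ Ioo a b, HasDerivAt F (F' s) s)
    (hG : ContinuousOn G (Icc a b)) (hG' : ∀ s ∈ Ioo a b, HasDerivAt G (G' s) s)
    (hFG : ∀ s ∈ Ioo a b, |F' s| ≤ G' s) : |F b - F a| ≤ G b - G a := by
  have hmono {σ : ℝ} (hσ : |σ| = 1) : MonotoneOn (fun s => G s + σ * F s) (Icc a b) := by
    have hderiv : ∀ s ∈ Ioo a b, HasDerivAt (fun s => G s + σ * F s) (G' s + σ * F' s) s :=
      fun s hs => (hG' s hs).add ((hF' s hs).const_mul σ)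
    rw [← interior_Icc] at hderiv hFG
    refine monotoneOn_of_deriv_nonneg (convex_Icc a b) (hG.add (continuousOn_const.mul hF))
      (fun s hs => (hderiv s hs).differentiableAt.differentiableWithinAt) fun s hs => ?_
    have hneg := neg_abs_le (σ * F' s)
    rw [abs_mul, hσ, one_mul] at hneg
    rw [(hderiv s hs).deriv]
    linarith [hFG s hs]
  have hplus := hmono abs_one (left_mem_Icc.2 hab) (right_mem_Icc.2 hab) hab
  have hminus := hmono (σ := -1) (by simp) (left_mem_Icc.2 hab) (right_mem_Icc.2 hab) hab
  simp only at hplus hminus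
  rw [abs_le]
  constructor <;> linarith

lemma abs_sub_le_of_abs_deriv_le_rpow {F F' : ℝ → ℝ} {B α : ℝ} (hα : α < 1)
    (hF : ContinuousOn F (Icc 0 1)) (hF' : ∀ s ∈ Ioo (0 : ℝ) 1, HasDerivAt F (F' s) s)
    (hB : ∀ s ∈ Ioo (0 : ℝ) 1, |F' s| ≤ B * s ^ (-α)) :
    |F 1 - F 0| ≤ B / (1 - α) := by
  have hα' : 0 < 1 - α := by linarith
  have hG' : ∀ s ∈ Ioo (0 : ℝ) 1,
      HasDerivAt (fun s => B / (1 - α) * s ^ (1 - α)) (B * s ^ (-α)) s := by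
    intro s hs
    refine ((Real.hasDerivAt_rpow_const (Or.inl hs.1.ne')).const_mul _).congr_deriv ?_
    rw [sub_sub_cancel_left]
    field_simp
  have hle := abs_sub_le_sub_of_abs_deriv_le zero_le_one hF hF'
    (continuousOn_const.mul (continuousOn_id.rpow_const fun s _ => Or.inr hα'.le)) hG' hB
  simpa [Real.zero_rpow hα'.ne'] using hle

theorem morrey_abs_integral_mul_sub_le {Q : Set (Fin d → ℝ)} (hf : Continuous f)
    (hg : IsWeakGradient f g) (hQ : Convex ℝ Q) (hQm : MeasurableSet Q) (hQcube : Q ⊆ cube d)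
    (hψ : ContDiff ℝ (⊤ : ℕ∞) ψ) (hψs : tsupport ψ ⊆ interior Q) (hψI : ∀ u, ψ u ∈ Icc (0 : ℝ) 1)
    {p : ℝ} (hp1 : 1 ≤ p) (hp : (d : ℝ) < p)
    (hgp : ∀ j, eLpNorm (g j) (ENNReal.ofReal p) (volume.restrict Q) ≠ ∞)
    (hx : x ∈ Q) {h : ℝ} (hh : ∀ u ∈ Q, ∀ j, |u j - x j| ≤ h) :
    |(∫ u, ψ u * f u) - (∫ u, ψ u) * f x| ≤
      (h * volume.real Q ^ (1 - 1 / p) *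
        ∑ j, (eLpNorm (g j) (ENNReal.ofReal p) (volume.restrict Q)).toReal) / (1 - d / p) := by
  have hψcube : tsupport ψ ⊆ interior (cube d) := hψs.trans (interior_mono hQcube)
  have hψ0 {u} : u ∉ cube d → ψ u = 0 := eq_zero_of_tsupport_subset_interior hψcube
  set F : ℝ → ℝ := fun s => ∫ u in cube d, ψ u * f (x + s • (u - x)) with hF
  have hFc : Continuous F := by
    refine continuous_parametric_integral_of_continuous ?_ (isCompact_cube d)
    have := hψ.continuous
    fun_prop
  have hF1 : F 1 = ∫ u, ψ u * f u := by
    simp only [hF, one_smul, add_sub_cancel]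
    exact setIntegral_eq_integral_of_forall_compl_eq_zero fun u hu => by rw [hψ0 hu, zero_mul]
  have hF0 : F 0 = (∫ u, ψ u) * f x := by
    simp only [hF, zero_smul, add_zero, integral_mul_const]
    rw [setIntegral_eq_integral_of_forall_compl_eq_zero fun u hu => hψ0 hu]
  rw [← hF1, ← hF0]
  refine abs_sub_le_of_abs_deriv_le_rpow ((div_lt_one (by linarith)).2 hp) hFc.continuousOn
    (fun s hs => hasDerivAt_integral_mul_comp_homothety hf hg hψ hψcube (hQcube hx) hs) ?_
  intro s hs
  refine (Finset.abs_sum_le_sum_abs _ _).trans ?_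
  rw [Finset.mul_sum, Finset.sum_mul]
  exact Finset.sum_le_sum fun j _ => abs_integral_mul_dilationFlux_le
    ((hg.aestronglyMeasurable j).mono_measure (Measure.restrict_mono hQcube le_rfl)) hQ hQm hQcube
    hψI (fun u => eq_zero_of_tsupport_subset_interior hψs) hp1 (hgp j) hx (fun u hu => hh u hu j) hs

end Morrey

/-! ### Finite sums of powers -/

section SumRpow

variable {ι : Type*} {s : Finset ι} {a : ι → ℝ} {p L : ℝ}

lemma sum_le_card_mul_of_sum_rpow_le (ha : ∀ i ∈ s, 0 ≤ a i) (hp : 1 ≤ p) (hL : 0 ≤ L)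
    (h : ∑ i ∈ s, a i ^ p ≤ L ^ p * s.card) : ∑ i ∈ s, a i ≤ s.card * L := by
  have hp0 : 0 < p := zero_lt_one.trans_le hp
  rcases s.eq_empty_or_nonempty with rfl | hs
  · simp
  have hcard : (0 : ℝ) < s.card := by exact_mod_cast hs.card_pos
  rw [← Real.rpow_le_rpow_iff (Finset.sum_nonneg ha) (by positivity) hp0]
  calc (∑ i ∈ s, a i) ^ p
      ≤ (s.card : ℝ) ^ (p - 1) * ∑ i ∈ s, a i ^ p :=
        Real.rpow_sum_le_const_mul_sum_rpow_of_nonneg s hp ha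
    _ ≤ (s.card : ℝ) ^ (p - 1) * (L ^ p * s.card) := by gcongr
    _ = (s.card * L) ^ p := by
      rw [Real.mul_rpow hcard.le hL, Real.rpow_sub_one hcard.ne']
      field_simp

lemma sum_rpow_le_rpow_sum_rpow (ha : ∀ i ∈ s, 0 ≤ a i) {r : ℝ} (hp : 0 < p) (hpr : p ≤ r) :
    ∑ i ∈ s, a i ^ r ≤ (∑ i ∈ s, a i ^ p) ^ (r / p) := by
  set T := ∑ i ∈ s, a i ^ p
  have hsplit : r / p = 1 + (r - p) / p := by field_simp; ring
  have hexp : 0 ≤ (r - p) / p := div_nonneg (sub_nonneg.2 hpr) hp.le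
  have hterm : ∀ i ∈ s, a i ^ r ≤ a i ^ p * T ^ ((r - p) / p) := by
    intro i hi
    have hle : a i ^ p ≤ T :=
      Finset.single_le_sum (f := fun i => a i ^ p) (fun i hi => Real.rpow_nonneg (ha i hi) p) hi
    have hpow : a i ^ (r - p) ≤ T ^ ((r - p) / p) := by
      have h := Real.rpow_le_rpow (Real.rpow_nonneg (ha i hi) p) hle hexp
      rwa [← Real.rpow_mul (ha i hi), mul_div_cancel₀ _ hp.ne'] at h
    calc a i ^ r = a i ^ p * a i ^ (r - p) := by
          rw [← Real.rpow_add' (ha i hi) (by linarith), add_sub_cancel]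
      _ ≤ _ := mul_le_mul_of_nonneg_left hpow (Real.rpow_nonneg (ha i hi) p)
  have hT : 0 ≤ T := Finset.sum_nonneg fun i hi => Real.rpow_nonneg (ha i hi) p
  refine (Finset.sum_le_sum hterm).trans_eq ?_
  rw [← Finset.sum_mul, hsplit, Real.rpow_add' hT (by linarith), Real.rpow_one]

lemma sum_sq_le_of_sum_rpow_le (ha : ∀ i ∈ s, 0 ≤ a i) (hp : 1 ≤ p) (hL : 0 ≤ L)
    (h : ∑ i ∈ s, a i ^ p ≤ L ^ p * s.card) :
    ∑ i ∈ s, a i ^ 2 ≤ L ^ 2 * (s.card : ℝ) ^ (2 / min p 2) := by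
  have hp0 : 0 < p := zero_lt_one.trans_le hp
  rcases le_total p 2 with hp2 | hp2
  · have hle := sum_rpow_le_rpow_sum_rpow ha hp0 hp2
    simp_rw [Real.rpow_two] at hle
    calc ∑ i ∈ s, a i ^ 2 ≤ (∑ i ∈ s, a i ^ p) ^ (2 / p) := hle
      _ ≤ (L ^ p * s.card) ^ (2 / p) := Real.rpow_le_rpow
          (Finset.sum_nonneg fun i hi => Real.rpow_nonneg (ha i hi) p) h (by positivity)
      _ = L ^ 2 * (s.card : ℝ) ^ (2 / min p 2) := by
          rw [min_eq_left hp2, Real.mul_rpow (by positivity) (by positivity), ← Real.rpow_mul hL,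
            mul_div_cancel₀ _ hp0.ne', Real.rpow_two]
  · have hsq {x : ℝ} (hx : 0 ≤ x) : (x ^ 2) ^ (p / 2) = x ^ p := by
      rw [← Real.rpow_two, ← Real.rpow_mul hx, mul_div_cancel₀ p two_ne_zero]
    rw [min_eq_right hp2, div_self two_ne_zero, Real.rpow_one, mul_comm]
    refine sum_le_card_mul_of_sum_rpow_le (p := p / 2) (fun i _ => sq_nonneg _) (by linarith)
      (sq_nonneg L) ?_
    rw [hsq hL, Finset.sum_congr rfl fun i hi => hsq (ha i hi)]
    exact h

end SumRpow

/-! ### Hoeffding's inequality -/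

section Hoeffding

variable {ι Ω : Type*} [Fintype ι] {mΩ : MeasurableSpace Ω} {P : Measure Ω}
  [IsProbabilityMeasure P] {Y : ι → Ω → ℝ} {c a : ι → ℝ}

lemma measure_abs_sum_sub_integral_ge_le (hind : iIndepFun Y P) (hY : ∀ i, AEMeasurable (Y i) P)
    (hmem : ∀ i, ∀ᵐ ω ∂P, Y i ω ∈ Icc (c i - a i) (c i + a i)) {V t : ℝ}
    (hV : ∑ i, a i ^ 2 ≤ V) (ht : 0 ≤ t) :
    P {ω | t ≤ |∑ i, (Y i ω - ∫ x, Y i x ∂P)|} ≤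
      ENNReal.ofReal (2 * Real.exp (-t ^ 2 / (2 * V))) := by
  have hV0 : 0 ≤ V := (Finset.sum_nonneg fun i _ => sq_nonneg (a i)).trans hV
  have hcentred : iIndepFun (fun i ω => Y i ω - ∫ x, Y i x ∂P) P :=
    hind.comp (fun i y => y - ∫ x, Y i x ∂P) (fun i => by fun_prop)
  have hsum := HasSubgaussianMGF.sum_of_iIndepFun hcentred (s := Finset.univ) fun i _ =>
    hasSubgaussianMGF_of_mem_Icc (hY i) (hmem i)
  have hvar : ((∑ i, (‖(c i + a i) - (c i - a i)‖₊ / 2) ^ 2 : NNReal) : ℝ) ≤ V.toNNReal := by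
    rw [Real.coe_toNNReal _ hV0]
    push_cast
    refine (Finset.sum_congr rfl fun i _ => ?_).trans_le hV
    rw [add_sub_sub_cancel, ← two_mul, norm_mul, Real.norm_ofNat,
      mul_div_cancel_left₀ _ two_ne_zero, Real.norm_eq_abs, sq_abs]
  have hsubgaussian : HasSubgaussianMGF (fun ω => ∑ i, (Y i ω - ∫ x, Y i x ∂P)) V.toNNReal P :=
    ⟨hsum.integrable_exp_mul, fun s => (hsum.mgf_le s).trans (by gcongr)⟩
  have hupper := hsubgaussian.measure_ge_le ht
  have hlower := hsubgaussian.neg.measure_ge_le ht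
  rw [Real.coe_toNNReal _ hV0] at hupper hlower
  have hunion : {ω | t ≤ |∑ i, (Y i ω - ∫ x, Y i x ∂P)|} ⊆
      {ω | t ≤ ∑ i, (Y i ω - ∫ x, Y i x ∂P)} ∪
        {ω | t ≤ (-fun ω => ∑ i, (Y i ω - ∫ x, Y i x ∂P)) ω} := fun ω hω => by
    simpa only [mem_union, mem_ofPred_eq, Pi.neg_apply] using le_abs.1 hω
  rw [← ofReal_measureReal]
  refine ENNReal.ofReal_le_ofReal ?_
  linarith [(measureReal_mono hunion).trans (measureReal_union_le (μ := P) _ _)]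

lemma ae_abs_sum_sub_integral_le (hY : ∀ i, AEMeasurable (Y i) P)
    (hmem : ∀ i, ∀ᵐ ω ∂P, Y i ω ∈ Icc (c i - a i) (c i + a i)) :
    ∀ᵐ ω ∂P, |∑ i, (Y i ω - ∫ x, Y i x ∂P)| ≤ 2 * ∑ i, a i := by
  have hmean (i) : |(∫ x, Y i x ∂P) - c i| ≤ a i := by
    have hint : Integrable (Y i) P := Integrable.of_mem_Icc _ _ (hY i) (hmem i)
    have hnorm : ∀ᵐ ω ∂P, ‖Y i ω - c i‖ ≤ a i := by
      filter_upwards [hmem i] with ω hω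
      rw [Real.norm_eq_abs, abs_sub_le_iff]
      constructor <;> linarith [hω.1, hω.2]
    have hle := norm_integral_le_of_norm_le_const hnorm
    rw [integral_sub hint (integrable_const _)] at hle
    simpa using hle
  filter_upwards [ae_all_iff.2 hmem] with ω hω
  refine (Finset.abs_sum_le_sum_abs _ _).trans ?_
  rw [Finset.mul_sum]
  refine Finset.sum_le_sum fun i _ => ?_
  have hmean_i := abs_le.1 (hmean i)
  rw [abs_le]
  constructor <;> linarith [(hω i).1, (hω i).2, hmean_i.1, hmean_i.2]

end Hoeffding

/-! ### Subcubes -/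

section Subcube

variable {d m : ℕ}

lemma mem_interior_cube {x : Fin d → ℝ} : x ∈ interior (cube d) ↔ ∀ j, 0 < x j ∧ x j < 1 := by
  rw [cube, ← pi_univ_Icc, interior_pi_set finite_univ]
  simp

/-- The lower corner of the subcube with index `i`. -/
noncomputable def corner (i : Fin d → Fin m) : Fin d → ℝ := fun j => ((i j : ℕ) : ℝ) / m

lemma subcube_eq (i : Fin d → Fin m) :
    subcube i = Set.pi univ fun j => Ico (corner i j) (corner i j + (m : ℝ)⁻¹) := by
  ext x
  simp [subcube, corner, add_div]

lemma measurableSet_subcube (i : Fin d → Fin m) : MeasurableSet (subcube i) := by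
  rw [subcube_eq]
  exact MeasurableSet.univ_pi fun j => measurableSet_Ico

lemma convex_subcube (i : Fin d → Fin m) : Convex ℝ (subcube i) := by
  rw [subcube_eq]
  exact convex_pi fun j _ => convex_Ico _ _

lemma abs_sub_le_of_mem_subcube {i : Fin d → Fin m} {x y : Fin d → ℝ} (hx : x ∈ subcube i)
    (hy : y ∈ subcube i) (j : Fin d) : |y j - x j| ≤ (m : ℝ)⁻¹ := by
  rw [subcube_eq] at hx hy
  have hxj := hx j trivial
  have hyj := hy j trivial
  rw [abs_le]
  constructor <;> linarith [hxj.1, hxj.2, hyj.1, hyj.2]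

lemma corner_nonneg (i : Fin d → Fin m) (j : Fin d) : 0 ≤ corner i j := by
  unfold corner
  positivity

lemma corner_add_inv_le_one (i : Fin d → Fin m) (j : Fin d) : corner i j + (m : ℝ)⁻¹ ≤ 1 := by
  rw [corner, ← one_div, ← add_div]
  exact div_le_one_of_le₀ (by exact_mod_cast (i j).2) m.cast_nonneg

lemma subcube_subset_cube (i : Fin d → Fin m) : subcube i ⊆ cube d := by
  intro x hx
  rw [subcube_eq] at hx
  exact mem_cube.2 fun j => ⟨(corner_nonneg i j).trans (hx j trivial).1,
    (hx j trivial).2.le.trans (corner_add_inv_le_one i j)⟩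

lemma volume_subcube (i : Fin d → Fin m) :
    volume (subcube i) = ENNReal.ofReal ((m : ℝ)⁻¹ ^ d) := by
  rw [subcube_eq, Real.volume_pi_Ico]
  simp only [add_sub_cancel_left, Finset.prod_const, Finset.card_univ, Fintype.card_fin]
  rw [ENNReal.ofReal_pow (by positivity)]

lemma eq_floor_of_mem_subcube {i : Fin d → Fin m} {x : Fin d → ℝ} (hx : x ∈ subcube i)
    (j : Fin d) : (i j : ℕ) = ⌊x j * m⌋₊ := by
  have hm : (0 : ℝ) < m := by exact_mod_cast (i j).pos
  obtain ⟨hle, hlt⟩ := hx j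
  rw [div_le_iff₀ hm] at hle
  rw [lt_div_iff₀ hm] at hlt
  exact ((Nat.floor_eq_iff ((Nat.cast_nonneg _).trans hle)).2 ⟨hle, hlt⟩).symm

lemma pairwise_disjoint_subcube :
    Pairwise (Function.onFun Disjoint (subcube : (Fin d → Fin m) → Set (Fin d → ℝ))) := by
  intro i i' hne
  refine Set.disjoint_left.2 fun x hx hx' => hne ?_
  ext j
  rw [eq_floor_of_mem_subcube hx, eq_floor_of_mem_subcube hx']

lemma iUnion_subcube (hm : 0 < m) :
    ⋃ i : Fin d → Fin m, subcube i = Set.pi univ fun _ => Ico (0 : ℝ) 1 := by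
  have hm' : (0 : ℝ) < m := by exact_mod_cast hm
  refine subset_antisymm (iUnion_subset fun i x hx j _ => ?_) fun x hx => mem_iUnion.2 ?_
  · rw [subcube_eq] at hx
    exact ⟨(corner_nonneg i j).trans (hx j trivial).1,
      (hx j trivial).2.trans_le (corner_add_inv_le_one i j)⟩
  · have hx0 (j) : 0 ≤ x j * m := mul_nonneg (hx j trivial).1 hm'.le
    have hlt (j) : ⌊x j * m⌋₊ < m := by
      rw [Nat.floor_lt (hx0 j)]
      exact mul_lt_of_lt_one_left hm' (hx j trivial).2
    exact ⟨fun j => ⟨⌊x j * m⌋₊, hlt j⟩, fun j => ⟨(div_le_iff₀ hm').2 (Nat.floor_le (hx0 j)),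
      (lt_div_iff₀ hm').2 (Nat.lt_floor_add_one _)⟩⟩

lemma iUnion_subcube_ae_eq (hm : 0 < m) :
    ⋃ i : Fin d → Fin m, subcube i =ᵐ[volume] cube d := by
  rw [iUnion_subcube hm]
  exact Measure.univ_pi_Ico_ae_eq_Icc

lemma sum_lintegral_subcube (hm : 0 < m) (F : (Fin d → ℝ) → ℝ≥0∞) :
    ∑ i : Fin d → Fin m, ∫⁻ x in subcube i, F x = ∫⁻ x in cube d, F x := by
  rw [← setLIntegral_congr (iUnion_subcube_ae_eq hm),
    lintegral_iUnion measurableSet_subcube pairwise_disjoint_subcube, tsum_fintype]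

lemma sum_integral_subcube (hm : 0 < m) {f : (Fin d → ℝ) → ℝ} (hf : IntegrableOn f (cube d)) :
    ∑ i : Fin d → Fin m, ∫ x in subcube i, f x = ∫ x in cube d, f x := by
  rw [← setIntegral_congr_set (iUnion_subcube_ae_eq hm),
    integral_iUnion_fintype measurableSet_subcube pairwise_disjoint_subcube
      (fun i => hf.mono_set (subcube_subset_cube i))]

lemma sum_eLpNorm_rpow_subcube (hm : 0 < m) {p : ℝ} (hp : 0 < p) (v : (Fin d → ℝ) → ℝ) :
    ∑ i : Fin d → Fin m, eLpNorm v (ENNReal.ofReal p) (volume.restrict (subcube i)) ^ p =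
      eLpNorm v (ENNReal.ofReal p) (volume.restrict (cube d)) ^ p := by
  have hlintegral (μ : Measure (Fin d → ℝ)) :
      eLpNorm v (ENNReal.ofReal p) μ ^ p = ∫⁻ x, ‖v x‖ₑ ^ p ∂μ := by
    rw [eLpNorm_eq_lintegral_rpow_enorm_toReal (by simpa using hp) ENNReal.ofReal_ne_top,
      ENNReal.toReal_ofReal hp.le, ← ENNReal.rpow_mul, one_div_mul_cancel hp.ne', ENNReal.rpow_one]
  simp_rw [hlintegral]
  exact sum_lintegral_subcube hm _

lemma eLpNorm_restrict_subcube_ne_top {p : ℝ≥0∞} {v : (Fin d → ℝ) → ℝ}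
    (hv : eLpNorm v p (volume.restrict (cube d)) ≤ 1) (i : Fin d → Fin m) :
    eLpNorm v p (volume.restrict (subcube i)) ≠ ∞ :=
  ((eLpNorm_mono_measure v (Measure.restrict_mono (subcube_subset_cube i) le_rfl)).trans_lt
    (hv.trans_lt ENNReal.one_lt_top)).ne

lemma sum_toReal_eLpNorm_rpow_subcube_le_one (hm : 0 < m) {p : ℝ} (hp : 0 < p)
    {v : (Fin d → ℝ) → ℝ} (hv : eLpNorm v (ENNReal.ofReal p) (volume.restrict (cube d)) ≤ 1) :
    ∑ i : Fin d → Fin m,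
      (eLpNorm v (ENNReal.ofReal p) (volume.restrict (subcube i))).toReal ^ p ≤ 1 := by
  simp_rw [ENNReal.toReal_rpow]
  rw [← ENNReal.toReal_sum fun i _ =>
    ENNReal.rpow_ne_top_of_nonneg hp.le (eLpNorm_restrict_subcube_ne_top hv i),
    sum_eLpNorm_rpow_subcube hm hp]
  exact ENNReal.toReal_le_of_le_ofReal zero_le_one (by simpa using ENNReal.rpow_le_one hv hp.le)

lemma sum_rpow_sum_eLpNorm_subcube_le (hm : 0 < m) {p : ℝ} (hp : 1 ≤ p)
    {g : Fin d → (Fin d → ℝ) → ℝ}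
    (hg : ∀ j, eLpNorm (g j) (ENNReal.ofReal p) (volume.restrict (cube d)) ≤ 1) :
    ∑ i : Fin d → Fin m, (∑ j, (eLpNorm (g j) (ENNReal.ofReal p)
      (volume.restrict (subcube i))).toReal) ^ p ≤ (d : ℝ) ^ p := by
  set G : (Fin d → Fin m) → Fin d → ℝ := fun i j =>
    (eLpNorm (g j) (ENNReal.ofReal p) (volume.restrict (subcube i))).toReal
  have hp0 : 0 < p := zero_lt_one.trans_le hp
  calc ∑ i, (∑ j, G i j) ^ p
      ≤ ∑ i, (d : ℝ) ^ (p - 1) * ∑ j, G i j ^ p := by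
        refine Finset.sum_le_sum fun i _ => ?_
        simpa using Real.rpow_sum_le_const_mul_sum_rpow_of_nonneg Finset.univ hp
          (f := G i) (fun j _ => ENNReal.toReal_nonneg)
    _ = (d : ℝ) ^ (p - 1) * ∑ j, ∑ i, G i j ^ p := by
        rw [← Finset.mul_sum, Finset.sum_comm]
    _ ≤ (d : ℝ) ^ (p - 1) * ∑ _j : Fin d, 1 := by
        gcongr with j
        exact sum_toReal_eLpNorm_rpow_subcube_le_one hm hp0 (hg j)
    _ = (d : ℝ) ^ p := by
        rcases d.eq_zero_or_pos with rfl | hd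
        · simp [Real.zero_rpow hp0.ne']
        · have hd' : (d : ℝ) ≠ 0 := by positivity
          simp [Real.rpow_sub_one hd', hd']

/-! ### Bump functions on subcubes -/

/-- A smooth bump function inside the unit cube. Transplanted to the subcubes, it serves both as an
averaging weight for the upper bound and as the perturbation of the integrand for the lower
bound. -/
structure IsCubeBump (φ : (Fin d → ℝ) → ℝ) : Prop where
  contDiff : ContDiff ℝ (⊤ : ℕ∞) φ
  tsupport_subset : tsupport φ ⊆ interior (cube d)
  mem_Icc : ∀ x, φ x ∈ Icc (0 : ℝ) 1
  integral_pos : 0 < ∫ x, φ x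

lemma exists_isCubeBump (d : ℕ) : ∃ φ : (Fin d → ℝ) → ℝ, IsCubeBump φ := by
  have hnhds : interior (cube d) ∈ nhds (fun _ : Fin d => (1 / 2 : ℝ)) :=
    isOpen_interior.mem_nhds (mem_interior_cube.2 fun _ => by norm_num)
  obtain ⟨φ, hsupport, hcompact, hsmooth, hrange, hone⟩ :=
    exists_contDiff_tsupport_subset (n := ⊤) hnhds
  have hφ (x) : φ x ∈ Icc (0 : ℝ) 1 := hrange (mem_range_self x)
  have hpos : 0 < ∫ x, φ x :=
    hsmooth.continuous.integral_pos_of_hasCompactSupport_nonneg_nonzero hcompact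
      (fun x => (hφ x).1) (hone ▸ one_ne_zero)
  exact ⟨φ, hsmooth, hsupport, hφ, hpos⟩

/-- The function `φ` on the unit cube, transplanted to the subcube with index `i`. -/
noncomputable def subcubeBump (φ : (Fin d → ℝ) → ℝ) (i : Fin d → Fin m) (x : Fin d → ℝ) : ℝ :=
  φ ((m : ℝ) • (x - corner i))

variable {φ : (Fin d → ℝ) → ℝ}

lemma contDiff_subcubeBump {n : WithTop ℕ∞} (hφ : ContDiff ℝ n φ) (i : Fin d → Fin m) :
    ContDiff ℝ n (subcubeBump φ i) := by
  unfold subcubeBump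
  fun_prop

lemma tsupport_subcubeBump_subset (hφ : tsupport φ ⊆ interior (cube d)) (i : Fin d → Fin m) :
    tsupport (subcubeBump φ i) ⊆ interior (subcube i) := by
  have hcont : Continuous fun x : Fin d → ℝ => (m : ℝ) • (x - corner i) := by fun_prop
  refine (tsupport_comp_subset_preimage φ hcont).trans ((preimage_mono hφ).trans
    (interior_maximal (fun x hx => ?_) (isOpen_interior.preimage hcont)))
  rw [subcube_eq]
  intro j _
  have hm : (0 : ℝ) < m := by exact_mod_cast (i j).pos
  obtain ⟨hpos, hlt⟩ : 0 < m * (x j - corner i j) ∧ m * (x j - corner i j) < 1 :=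
    mem_interior_cube.1 hx j
  have hlt' : x j - corner i j < (m : ℝ)⁻¹ := by rwa [← one_div, lt_div_iff₀' hm]
  exact ⟨(sub_pos.1 (pos_of_mul_pos_right hpos hm.le)).le, sub_lt_iff_lt_add'.1 hlt'⟩

lemma integral_subcubeBump (i : Fin d → Fin m) :
    ∫ x, subcubeBump φ i x = (m : ℝ)⁻¹ ^ d * ∫ x, φ x := by
  simp only [subcubeBump]
  rw [integral_sub_right_eq_self (fun x => φ ((m : ℝ) • x)) (corner i),
    Measure.integral_comp_smul, Module.finrank_fin_fun, abs_of_nonneg (by positivity),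
    smul_eq_mul, inv_pow]

end Subcube

/-! ### Oscillation on the subcubes -/

section Oscillation

variable {d m : ℕ} {p : ℝ} {φ f : (Fin d → ℝ) → ℝ} {g : Fin d → (Fin d → ℝ) → ℝ}

lemma IsCubeBump.abs_integral_subcubeBump_div_sub_le (hφ : IsCubeBump φ) (hf : Continuous f)
    (hg : IsWeakGradient f g) (hp1 : 1 ≤ p) (hp : (d : ℝ) < p)
    (hgp : ∀ j, eLpNorm (g j) (ENNReal.ofReal p) (volume.restrict (cube d)) ≤ 1) (hm : 0 < m)
    {i : Fin d → Fin m} {x : Fin d → ℝ} (hx : x ∈ subcube i) :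
    |(∫ u, subcubeBump φ i u * f u) / (∫ u, subcubeBump φ i u) - f x| ≤
      ((1 - d / p) * ∫ u, φ u)⁻¹ * ((m : ℝ)⁻¹ * ((m : ℝ) ^ d) ^ (1 / p)) *
        ∑ j, (eLpNorm (g j) (ENNReal.ofReal p) (volume.restrict (subcube i))).toReal := by
  have hI := hφ.integral_pos
  have : 0 < 1 - d / p := by
    rw [sub_pos, div_lt_one (zero_lt_one.trans_le hp1)]
    exact hp
  have hvol : volume.real (subcube i) = ((m : ℝ) ^ d)⁻¹ := by
    rw [Measure.real, volume_subcube, ENNReal.toReal_ofReal (by positivity), inv_pow]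
  have hψpos : 0 < ∫ u, subcubeBump φ i u := by
    rw [integral_subcubeBump]
    positivity
  have hmorrey := morrey_abs_integral_mul_sub_le hf hg (convex_subcube i) (measurableSet_subcube i)
    (subcube_subset_cube i) (contDiff_subcubeBump hφ.contDiff i)
    (tsupport_subcubeBump_subset hφ.tsupport_subset i) (fun u => hφ.mem_Icc _) hp1 hp
    (fun j => eLpNorm_restrict_subcube_ne_top (hgp j) i) hx
    (fun u hu => abs_sub_le_of_mem_subcube hx hu)
  rw [div_sub' hψpos.ne', abs_div, abs_of_pos hψpos, div_le_iff₀ hψpos]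
  refine hmorrey.trans_eq ?_
  rw [hvol, integral_subcubeBump, Real.inv_rpow (by positivity),
    Real.rpow_sub (by positivity), Real.rpow_one, inv_pow]
  field_simp

/-- On the subcube with index `i`, the function `f` deviates from a constant `c i` by at most `a i`,
and the `ℓ_p`-mean of the radii `a i` over all `m ^ d` subcubes is at most `L`. -/
def HasOscillationBound (p L : ℝ) (m : ℕ) (f : (Fin d → ℝ) → ℝ) : Prop :=
  ∃ c a : (Fin d → Fin m) → ℝ, (∀ i, 0 ≤ a i) ∧
    (∀ i, ∀ x ∈ subcube i, f x ∈ Icc (c i - a i) (c i + a i)) ∧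
    ∑ i, a i ^ p ≤ L ^ p * (m : ℝ) ^ d

theorem exists_hasOscillationBound (hd : 1 ≤ d) (hp : (d : ℝ) < p) :
    ∃ A : ℝ, 0 < A ∧ ∀ (f : (Fin d → ℝ) → ℝ) (g : Fin d → (Fin d → ℝ) → ℝ), Continuous f →
      IsWeakGradient f g →
      (∀ j, eLpNorm (g j) (ENNReal.ofReal p) (volume.restrict (cube d)) ≤ 1) →
      ∀ m : ℕ, 0 < m → HasOscillationBound p (A * (m : ℝ)⁻¹) m f := by
  obtain ⟨φ, hφ⟩ := exists_isCubeBump d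
  have hp1 : 1 ≤ p := (Nat.one_le_cast.2 hd).trans hp.le
  have hp0 : 0 < p := zero_lt_one.trans_le hp1
  have hα : 0 < 1 - d / p := by
    rw [sub_pos, div_lt_one hp0]
    exact hp
  have hI := hφ.integral_pos
  set K := ((1 - d / p) * ∫ u, φ u)⁻¹
  have : 0 < K := by positivity
  refine ⟨K * d, by positivity, fun f g hf hg hgp m hm => ?_⟩
  set G : (Fin d → Fin m) → ℝ := fun i =>
    ∑ j, (eLpNorm (g j) (ENNReal.ofReal p) (volume.restrict (subcube i))).toReal
  have hG (i) : 0 ≤ G i := Finset.sum_nonneg fun j _ => ENNReal.toReal_nonneg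
  set B := K * ((m : ℝ)⁻¹ * ((m : ℝ) ^ d) ^ (1 / p))
  refine ⟨fun i => (∫ u, subcubeBump φ i u * f u) / ∫ u, subcubeBump φ i u, fun i => B * G i,
    fun i => mul_nonneg (by positivity) (hG i), fun i x hx => ?_, ?_⟩
  · have hdev := abs_sub_le_iff.1 (hφ.abs_integral_subcubeBump_div_sub_le hf hg hp1 hp hgp hm hx)
    constructor <;> linarith [hdev.1, hdev.2]
  · have hB : B ^ p = (K * (m : ℝ)⁻¹) ^ p * (m : ℝ) ^ d := by
      rw [show B = K * (m : ℝ)⁻¹ * ((m : ℝ) ^ d) ^ (1 / p) from (mul_assoc _ _ _).symm,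
        Real.mul_rpow (by positivity) (by positivity), ← Real.rpow_mul (by positivity),
        one_div_mul_cancel hp0.ne', Real.rpow_one]
    calc ∑ i, (B * G i) ^ p = B ^ p * ∑ i, G i ^ p := by
          rw [Finset.mul_sum]
          exact Finset.sum_congr rfl fun i _ => Real.mul_rpow (by positivity) (hG i)
      _ ≤ B ^ p * (d : ℝ) ^ p := by
          gcongr
          exact sum_rpow_sum_eLpNorm_subcube_le hm hp1 hgp
      _ = (K * d * (m : ℝ)⁻¹) ^ p * (m : ℝ) ^ d := by
          rw [hB, mul_right_comm K, Real.mul_rpow (by positivity : 0 ≤ K * (m : ℝ)⁻¹) d.cast_nonneg]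
          ring

end Oscillation

/-! ### The error of stratified sampling -/

section Stratified

variable {d m : ℕ} {Ω : Type*} [MeasurableSpace Ω] {P : Measure Ω}
  {X : (Fin d → Fin m) → Ω → (Fin d → ℝ)} {f : (Fin d → ℝ) → ℝ}

lemma IsStratifiedSample.ae_mem (hX : IsStratifiedSample P X) (i : Fin d → Fin m) :
    ∀ᵐ ω ∂P, X i ω ∈ subcube i := by
  refine ae_of_ae_map (hX.1 i).aemeasurable (p := fun x => x ∈ subcube i) ?_
  rw [hX.2.2 i]
  exact ae_cond_mem (measurableSet_subcube i)

lemma IsStratifiedSample.integral_eq (hX : IsStratifiedSample P X) (hf : Continuous f)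
    (i : Fin d → Fin m) : ∫ ω, f (X i ω) ∂P = (m : ℝ) ^ d * ∫ x in subcube i, f x := by
  rw [← integral_map (hX.1 i).aemeasurable hf.aestronglyMeasurable, hX.2.2 i,
    ProbabilityTheory.cond, integral_smul_measure, volume_subcube, ENNReal.toReal_inv,
    ENNReal.toReal_ofReal (by positivity), inv_pow, inv_inv, smul_eq_mul]

lemma IsStratifiedSample.card_mul_abs_stratified_sub (hX : IsStratifiedSample P X) (hm : 0 < m)
    (hf : Continuous f) (ω : Ω) :
    (m : ℝ) ^ d * |stratified X ω f - integralCube d f| =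
      |∑ i, (f (X i ω) - ∫ x, f (X i x) ∂P)| := by
  have hm' : (0 : ℝ) < (m : ℝ) ^ d := by positivity
  have hmul (x : ℝ) : (m : ℝ) ^ d * |x| = |(m : ℝ) ^ d * x| := by rw [abs_mul, abs_of_pos hm']
  rw [hmul, Finset.sum_sub_distrib]
  simp_rw [hX.integral_eq hf]
  rw [← Finset.mul_sum, sum_integral_subcube hm
    (hf.continuousOn.integrableOn_compact (isCompact_cube d)), stratified, integralCube, mul_sub,
    ← mul_assoc, mul_one_div_cancel hm'.ne', one_mul]

variable [IsProbabilityMeasure P] {p L : ℝ}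

lemma HasOscillationBound.ae_abs_stratified_sub_le (h : HasOscillationBound p L m f)
    (hX : IsStratifiedSample P X) (hm : 0 < m) (hf : Continuous f) (hp : 1 ≤ p) (hL : 0 ≤ L) :
    ∀ᵐ ω ∂P, |stratified X ω f - integralCube d f| ≤ 2 * L := by
  obtain ⟨c, a, ha, hfa, hsum⟩ := h
  have hmean := sum_le_card_mul_of_sum_rpow_le (s := Finset.univ) (fun i _ => ha i) hp hL
    (by simpa using hsum)
  simp only [Finset.card_univ, Fintype.card_pi_const, Fintype.card_fin, Nat.cast_pow] at hmean
  filter_upwards [ae_abs_sum_sub_integral_le (Y := fun i ω => f (X i ω))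
    (fun i => (hf.measurable.comp (hX.1 i)).aemeasurable)
    (fun i => (hX.ae_mem i).mono fun ω hω => hfa i _ hω)] with ω hω
  rw [← hX.card_mul_abs_stratified_sub hm hf] at hω
  refine le_of_mul_le_mul_left ?_ (by positivity : (0 : ℝ) < (m : ℝ) ^ d)
  linarith

lemma HasOscillationBound.measure_lt_abs_stratified_sub_le_exp (h : HasOscillationBound p L m f)
    (hX : IsStratifiedSample P X) (hm : 0 < m) (hf : Continuous f) (hp : 1 ≤ p) (hL : 0 < L)
    {s : ℝ} (hs : 0 ≤ s) :
    P {ω | 2 * L * (((m : ℝ) ^ d) ^ (-(1 - 1 / min p 2)) * s) <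
      |stratified X ω f - integralCube d f|} ≤ ENNReal.ofReal (2 * Real.exp (-2 * s ^ 2)) := by
  obtain ⟨c, a, ha, hfa, hsum⟩ := h
  have hvar := sum_sq_le_of_sum_rpow_le (s := Finset.univ) (fun i _ => ha i) hp hL.le
    (by simpa using hsum)
  simp only [Finset.card_univ, Fintype.card_pi_const, Fintype.card_fin, Nat.cast_pow] at hvar
  set N : ℝ := (m : ℝ) ^ d
  have hN : 0 < N := by positivity
  set q := min p 2
  have hind : iIndepFun (fun i ω => f (X i ω)) P :=
    hX.2.1.comp (fun _ => f) (fun _ => hf.measurable)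
  have htail := measure_abs_sum_sub_integral_ge_le hind
    (fun i => (hf.measurable.comp (hX.1 i)).aemeasurable)
    (fun i => (hX.ae_mem i).mono fun ω hω => hfa i _ hω) hvar
    (t := N * (2 * L * (N ^ (-(1 - 1 / q)) * s))) (by positivity)
  simp_rw [← hX.card_mul_abs_stratified_sub hm hf] at htail
  have hpow : (N * N ^ (-(1 - 1 / q))) ^ 2 = N ^ (2 / q) := by
    rw [← Real.rpow_one_add' hN.le (by rw [neg_sub, add_sub_cancel]; positivity),
      ← Real.rpow_mul_natCast hN.le, neg_sub, add_sub_cancel, one_div_mul_eq_div, Nat.cast_two]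
  have hNq : 0 < N ^ (2 / q) := by positivity
  have hexponent : -(N * (2 * L * (N ^ (-(1 - 1 / q)) * s))) ^ 2 / (2 * (L ^ 2 * N ^ (2 / q))) =
      -2 * s ^ 2 := by
    rw [← hpow] at hNq ⊢
    field_simp
  rw [hexponent] at htail
  exact (measure_mono fun ω hω => mul_le_mul_of_nonneg_left (le_of_lt hω) hN.le).trans htail

theorem HasOscillationBound.measure_lt_abs_stratified_sub_le (h : HasOscillationBound p L m f)
    (hX : IsStratifiedSample P X) (hm : 0 < m) (hf : Continuous f) (hp : 1 ≤ p) (hL : 0 < L)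
    {δ : ℝ} (hδ : δ ∈ Ioo (0 : ℝ) (1 / 2)) :
    P {ω | 2 * L * min 1 (((m : ℝ) ^ d) ^ (-(1 - 1 / min p 2)) * √(Real.log δ⁻¹)) <
      |stratified X ω f - integralCube d f|} ≤ ENNReal.ofReal δ := by
  rcases min_choice 1 (((m : ℝ) ^ d) ^ (-(1 - 1 / min p 2)) * √(Real.log δ⁻¹)) with hmin | hmin
  · have hae := h.ae_abs_stratified_sub_le hX hm hf hp hL.le
    have hzero : P {ω | 2 * L < |stratified X ω f - integralCube d f|} = 0 := by
      rw [measure_eq_zero_iff_ae_notMem]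
      exact hae.mono fun ω hω => not_lt.2 hω
    rw [hmin, mul_one, hzero]
    exact zero_le
  · have hlog : 0 ≤ Real.log δ⁻¹ :=
      Real.log_nonneg ((one_le_inv₀ hδ.1).2 (by linarith [hδ.2]))
    rw [hmin]
    refine (h.measure_lt_abs_stratified_sub_le_exp hX hm hf hp hL (Real.sqrt_nonneg _)).trans ?_
    calc ENNReal.ofReal (2 * Real.exp (-2 * √(Real.log δ⁻¹) ^ 2))
        = ENNReal.ofReal (2 * δ ^ 2) := by
          rw [Real.sq_sqrt hlog, Real.log_inv, neg_mul_neg, ← Nat.cast_two (R := ℝ),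
            ← Real.log_pow, Real.exp_log (pow_pos hδ.1 2), Nat.cast_two]
      _ ≤ ENNReal.ofReal δ := ENNReal.ofReal_le_ofReal (by nlinarith [hδ.1, hδ.2])

end Stratified

/-! ### Functions on the cube -/

/-- The coordinatewise projection onto the cube. Composition with it extends a function that is
continuous on the cube to a continuous function on the whole space. -/
noncomputable def cubeProj (d : ℕ) (x : Fin d → ℝ) : cube d :=
  ⟨0 ⊔ 1 ⊓ x, le_sup_left, sup_le zero_le_one inf_le_left⟩

lemma cubeProj_of_mem {d : ℕ} {x : Fin d → ℝ} (hx : x ∈ cube d) :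
    (cubeProj d x : Fin d → ℝ) = x := by
  simp only [cubeProj, inf_eq_right.2 hx.2, sup_eq_right.2 hx.1]

lemma continuous_comp_cubeProj {d : ℕ} {f : (Fin d → ℝ) → ℝ} (hf : ContinuousOn f (cube d)) :
    Continuous fun x => f (cubeProj d x) := by
  have hproj : Continuous fun x : Fin d → ℝ => 0 ⊔ 1 ⊓ x :=
    continuous_pi fun j => continuous_const.sup (continuous_const.inf (continuous_apply j))
  exact hf.comp_continuous hproj fun x => (cubeProj d x).2

lemma eqOn_comp_cubeProj {d : ℕ} (f : (Fin d → ℝ) → ℝ) :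
    EqOn f (fun x => f (cubeProj d x)) (cube d) := fun x hx => by
  simp only [cubeProj_of_mem hx]

lemma integralCube_congr {d : ℕ} {f f' : (Fin d → ℝ) → ℝ} (h : EqOn f f' (cube d)) :
    integralCube d f = integralCube d f' :=
  setIntegral_congr_fun (measurableSet_cube d) h

lemma IsWeakGradient.congr {d : ℕ} {f f' : (Fin d → ℝ) → ℝ} {g : Fin d → (Fin d → ℝ) → ℝ}
    (hg : IsWeakGradient f g) (h : EqOn f f' (cube d)) : IsWeakGradient f' g := by
  refine fun j => ⟨(hg j).1, fun φ hφ hφc hφs => ?_⟩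
  rw [← (hg j).2 φ hφ hφc hφs]
  exact setIntegral_congr_fun (measurableSet_cube d) fun x hx => by simp only [h hx]

lemma IsStratifiedSample.ae_stratified_congr {d m : ℕ} {Ω : Type*} [MeasurableSpace Ω]
    {P : Measure Ω} {X : (Fin d → Fin m) → Ω → (Fin d → ℝ)} (hX : IsStratifiedSample P X)
    {f f' : (Fin d → ℝ) → ℝ} (h : EqOn f f' (cube d)) :
    ∀ᵐ ω ∂P, stratified X ω f = stratified X ω f' := by
  filter_upwards [ae_all_iff.2 hX.ae_mem] with ω hω
  simp only [stratified, fun i => h (subcube_subset_cube i (hω i))]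

/-! ### The integrability exponent -/

section Exponent

variable {d : ℕ} {p : ℝ≥0∞}

/-- The exponent `p`, with `p = ∞` replaced by the finite exponent `d + 1 > d`: on the cube the
`L_{d+1}`-norm is at most the `L_∞`-norm, and `min p 2` does not change. -/
noncomputable def finiteExponent (d : ℕ) (p : ℝ≥0∞) : ℝ := if p = ∞ then d + 1 else p.toReal

lemma lt_finiteExponent (hp : (d : ℝ≥0∞) < p) : (d : ℝ) < finiteExponent d p := by
  unfold finiteExponent
  split_ifs with hpt
  · linarith
  · simpa using (ENNReal.toReal_lt_toReal (ENNReal.natCast_ne_top d) hpt).2 hp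

lemma min_finiteExponent (hd : 1 ≤ d) (p : ℝ≥0∞) :
    min (finiteExponent d p) 2 = (min p 2).toReal := by
  unfold finiteExponent
  split_ifs with hpt
  · have hd' : (1 : ℝ) ≤ d := by exact_mod_cast hd
    rw [min_eq_right (by linarith), hpt, min_eq_right le_top, ENNReal.toReal_ofNat]
  · rw [ENNReal.toReal_min hpt ENNReal.ofNat_ne_top, ENNReal.toReal_ofNat]

lemma eLpNorm_le_one_of_sobolevNorm_le_one (hp : (d : ℝ≥0∞) < p) {f : (Fin d → ℝ) → ℝ}
    {g : Fin d → (Fin d → ℝ) → ℝ} (hg : IsWeakGradient f g) (h : sobolevNorm p f g ≤ 1)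
    (j : Fin d) :
    eLpNorm (g j) (ENNReal.ofReal (finiteExponent d p)) (volume.restrict (cube d)) ≤ 1 := by
  unfold sobolevNorm at h
  unfold finiteExponent
  split_ifs at h ⊢ with hpt
  · exact (eLpNorm_le_eLpNorm_of_exponent_le le_top (hg.aestronglyMeasurable j)).trans
      ((le_iSup (fun j => eLpNorm (g j) ∞ (volume.restrict (cube d))) j).trans
        ((le_max_right _ _).trans h))
  · have hp0 : 0 < p.toReal := ENNReal.toReal_pos (zero_le.trans_lt hp).ne' hpt
    rw [ENNReal.ofReal_toReal hpt, ← ENNReal.rpow_le_rpow_iff hp0, ENNReal.one_rpow]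
    rw [← ENNReal.rpow_le_rpow_iff hp0, ENNReal.one_rpow, ← ENNReal.rpow_mul,
      one_div_mul_cancel hp0.ne', ENNReal.rpow_one] at h
    exact ((Finset.single_le_sum (f := fun j =>
      eLpNorm (g j) p (volume.restrict (cube d)) ^ p.toReal) (fun _ _ => zero_le)
      (Finset.mem_univ j)).trans le_add_self).trans h

end Exponent

/-! ### The grid size -/

section GridSize

variable {d n : ℕ}

lemma rpow_one_div_pow_natCast (hd : 1 ≤ d) (n : ℕ) : ((n : ℝ) ^ (1 / (d : ℝ))) ^ d = n := by
  rw [one_div, Real.rpow_inv_natCast_pow n.cast_nonneg (Nat.one_le_iff_ne_zero.1 hd)]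

lemma gridSize_pow_le (hd : 1 ≤ d) (n : ℕ) : gridSize d n ^ d ≤ n := by
  have hreal : (gridSize d n : ℝ) ^ d ≤ n :=
    (pow_le_pow_left₀ (Nat.cast_nonneg _) (Nat.floor_le (by positivity)) d).trans_eq
      (rpow_one_div_pow_natCast hd n)
  exact_mod_cast hreal

lemma gridSize_pos (d : ℕ) (hn : 1 ≤ n) : 0 < gridSize d n :=
  Nat.floor_pos.2 (Real.one_le_rpow (by exact_mod_cast hn) (by positivity))

lemma rpow_one_div_le_two_mul_gridSize (d : ℕ) (hn : 1 ≤ n) :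
    (n : ℝ) ^ (1 / (d : ℝ)) ≤ 2 * gridSize d n := by
  have hlt : (n : ℝ) ^ (1 / (d : ℝ)) < gridSize d n + 1 := Nat.lt_floor_add_one _
  have hone : (1 : ℝ) ≤ gridSize d n := by exact_mod_cast gridSize_pos d hn
  linarith

lemma inv_gridSize_le (d : ℕ) (hn : 1 ≤ n) :
    (gridSize d n : ℝ)⁻¹ ≤ 2 * (n : ℝ) ^ (-(1 / (d : ℝ))) := by
  have hm : (0 : ℝ) < gridSize d n := by exact_mod_cast gridSize_pos d hn
  have hn0 : (0 : ℝ) < n := by exact_mod_cast hn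
  rw [Real.rpow_neg hn0.le, ← div_eq_mul_inv, inv_le_iff_one_le_mul₀ hm, div_mul_eq_mul_div,
    one_le_div (by positivity)]
  exact rpow_one_div_le_two_mul_gridSize d hn

lemma gridSize_pow_rpow_neg_le (hd : 1 ≤ d) (hn : 1 ≤ n) {β : ℝ} (hβ : β ∈ Icc (0 : ℝ) 1) :
    ((gridSize d n : ℝ) ^ d) ^ (-β) ≤ 2 ^ d * (n : ℝ) ^ (-β) := by
  have hn0 : (0 : ℝ) < n := by exact_mod_cast hn
  have hm : (0 : ℝ) < gridSize d n := by exact_mod_cast gridSize_pos d hn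
  have hpow : (n : ℝ) ≤ 2 ^ d * (gridSize d n : ℝ) ^ d := by
    rw [← mul_pow, ← rpow_one_div_pow_natCast hd n]
    gcongr
    exact rpow_one_div_le_two_mul_gridSize d hn
  have htwo : ((2 : ℝ) ^ d) ^ β ≤ 2 ^ d :=
    (Real.rpow_le_rpow_of_exponent_le (one_le_pow₀ one_le_two) hβ.2).trans_eq (Real.rpow_one _)
  rw [Real.rpow_neg (by positivity), Real.rpow_neg hn0.le, ← div_eq_mul_inv,
    inv_le_iff_one_le_mul₀ (by positivity), div_mul_eq_mul_div, one_le_div (by positivity)]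
  calc (n : ℝ) ^ β ≤ (2 ^ d * (gridSize d n : ℝ) ^ d) ^ β := Real.rpow_le_rpow hn0.le hpow hβ.1
    _ = ((2 : ℝ) ^ d) ^ β * ((gridSize d n : ℝ) ^ d) ^ β :=
        Real.mul_rpow (by positivity) (by positivity)
    _ ≤ 2 ^ d * ((gridSize d n : ℝ) ^ d) ^ β := by gcongr

lemma gridSize_rate_le (hd : 1 ≤ d) {q : ℝ} (hq : 1 ≤ q) (hn : 1 ≤ n) (δ : ℝ) :
    (gridSize d n : ℝ)⁻¹ *
      min 1 (((gridSize d n : ℝ) ^ d) ^ (-(1 - 1 / q)) * √(Real.log δ⁻¹)) ≤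
      2 * 2 ^ d * rate d q n δ := by
  have hβ : 1 - 1 / q ∈ Icc (0 : ℝ) 1 :=
    ⟨sub_nonneg.2 ((div_le_one (by linarith)).2 hq), sub_le_self _ (by positivity)⟩
  have hmin : min 1 (((gridSize d n : ℝ) ^ d) ^ (-(1 - 1 / q)) * √(Real.log δ⁻¹)) ≤
      2 ^ d * min 1 ((n : ℝ) ^ (-(1 - 1 / q)) * √(Real.log δ⁻¹)) := by
    rw [mul_min_of_nonneg _ _ (by positivity), mul_one, ← mul_assoc]
    gcongr
    · exact one_le_pow₀ one_le_two
    · exact gridSize_pow_rpow_neg_le hd hn hβ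
  calc _ ≤ (2 * (n : ℝ) ^ (-(1 / (d : ℝ)))) *
        (2 ^ d * min 1 ((n : ℝ) ^ (-(1 - 1 / q)) * √(Real.log δ⁻¹))) :=
        mul_le_mul (inv_gridSize_le d hn) hmin (by positivity) (by positivity)
    _ = 2 * 2 ^ d * rate d q n δ := by
        unfold rate
        ring

lemma rate_pos (d : ℕ) (q : ℝ) (hn : 1 ≤ n) {δ : ℝ} (hδ : δ ∈ Ioo (0 : ℝ) 1) :
    0 < rate d q n δ := by
  have : 0 < n := hn
  have hlog : 0 < Real.log δ⁻¹ := Real.log_pos ((one_lt_inv₀ hδ.1).2 hδ.2)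
  unfold rate
  positivity

end GridSize

/-! ### The upper bound -/

theorem exists_stratified_isApproximating {d : ℕ} (hd : 1 ≤ d) {p : ℝ≥0∞}
    (hp : (d : ℝ≥0∞) < p) :
    ∃ c : ℝ, 0 < c ∧ ∀ n : ℕ, 1 ≤ n → ∀ δ ∈ Ioo (0 : ℝ) (1 / 2),
      ∀ (Ω : Type*) [MeasurableSpace Ω] (P : Measure Ω) [IsProbabilityMeasure P]
        (X : (Fin d → Fin (gridSize d n)) → Ω → (Fin d → ℝ)), IsStratifiedSample P X →
        IsApproximating P (stratified X) (sobolevBall d p)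
          (c * rate d (min p 2).toReal n δ) δ := by
  have hp' := lt_finiteExponent hp
  have hp1 : 1 ≤ finiteExponent d p := (Nat.one_le_cast.2 hd).trans hp'.le
  obtain ⟨A, hA, hosc⟩ := exists_hasOscillationBound hd hp'
  refine ⟨2 * A * (2 * 2 ^ d), by positivity, fun n hn δ hδ Ω _ P _ X hX f hf => ?_⟩
  obtain ⟨hfc, g, hg, hnorm⟩ := hf
  have hm := gridSize_pos d hn
  have hf' := continuous_comp_cubeProj hfc
  have hosc_f := hosc _ g hf' (hg.congr (eqOn_comp_cubeProj f))
    (eLpNorm_le_one_of_sobolevNorm_le_one hp hg hnorm) _ hm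
  refine (measure_mono_ae ?_).trans
    (hosc_f.measure_lt_abs_stratified_sub_le hX hm hf' hp1 (by positivity) hδ)
  filter_upwards [hX.ae_stratified_congr (eqOn_comp_cubeProj f)] with ω hω
  have hrate := gridSize_rate_le hd (le_min hp1 one_le_two) hn δ
  rw [min_finiteExponent hd] at hrate ⊢
  intro (hlt : _ < |_ - _|)
  rw [hω, integralCube_congr (eqOn_comp_cubeProj f)] at hlt
  refine lt_of_le_of_lt ?_ hlt
  have hscaled := mul_le_mul_of_nonneg_left hrate (by positivity : 0 ≤ 2 * A)
  linarith

/-! ### Stratified sampling as an algorithm -/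

section Algorithm

variable {d m n : ℕ}

lemma length_collect (node : List ℝ → cube d) (f : (Fin d → ℝ) → ℝ) (n : ℕ) :
    (collect node f n).length = n := by
  induction n with
  | zero => rfl
  | succ n ih => simp [collect, ih]

lemma getD_collect (node : List ℝ → cube d) (f : (Fin d → ℝ) → ℝ) {k : ℕ} (hk : k < n) :
    (collect node f n).getD k 0 = f (node (collect node f k)) := by
  induction n with
  | zero => omega
  | succ n ih =>
    rw [collect]
    rcases Nat.lt_succ_iff_lt_or_eq.1 hk with hlt | rfl
    · rw [List.getD_append _ _ _ _ (by rwa [length_collect]), ih hlt]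
    · rw [List.getD_append_right _ _ _ _ (by rw [length_collect])]
      simp [length_collect]

variable (d m) in
/-- An enumeration of the subcubes, fixing the order in which the algorithm visits them. -/
noncomputable def subcubeIndex : (Fin d → Fin m) ≃ Fin (m ^ d) :=
  Fintype.equivFinOfCardEq (by simp)

/-- The next sample point of stratified sampling after the function values `y`. The budget may
exceed `m ^ d`; the superfluous values are taken at an arbitrary point and are ignored by
`stratifiedOutput`. -/
noncomputable def stratifiedNode (ω : (Fin d → Fin m) → (Fin d → ℝ)) (y : List ℝ) : cube d :=
  if h : y.length < m ^ d then cubeProj d (ω ((subcubeIndex d m).symm ⟨y.length, h⟩))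
  else cubeProj d 0

variable (d m) in
/-- The average of the first `m ^ d` function values. -/
noncomputable def stratifiedOutput (y : List ℝ) : ℝ :=
  1 / (m : ℝ) ^ d * ∑ i, y.getD (subcubeIndex d m i) 0

lemma stratifiedOutput_collect (hn : m ^ d ≤ n) (ω : (Fin d → Fin m) → (Fin d → ℝ))
    (f : (Fin d → ℝ) → ℝ) :
    stratifiedOutput d m (collect (stratifiedNode ω) f n) =
      stratified (fun i ω => ω i) ω (fun x => f (cubeProj d x)) := by
  unfold stratifiedOutput stratified
  congr 1
  refine Finset.sum_congr rfl fun i _ => ?_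
  rw [getD_collect _ _ ((subcubeIndex d m i).2.trans_le hn), stratifiedNode,
    dif_pos (by rw [length_collect]; exact (subcubeIndex d m i).2)]
  simp [length_collect]

variable (d m) in
/-- The joint distribution of the sample points of stratified sampling. -/
noncomputable def stratifiedMeasure : Measure ((Fin d → Fin m) → (Fin d → ℝ)) :=
  Measure.pi fun i => ProbabilityTheory.cond volume (subcube i)

lemma isProbabilityMeasure_cond_subcube (hm : 0 < m) (i : Fin d → Fin m) :
    IsProbabilityMeasure (ProbabilityTheory.cond volume (subcube i)) := by
  refine cond_isProbabilityMeasure_of_finite ?_ ?_ <;> rw [volume_subcube]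
  · exact (ENNReal.ofReal_pos.2 (by positivity)).ne'
  · exact ENNReal.ofReal_ne_top

lemma isProbabilityMeasure_stratifiedMeasure (hm : 0 < m) :
    IsProbabilityMeasure (stratifiedMeasure d m) := by
  have := isProbabilityMeasure_cond_subcube (d := d) hm
  unfold stratifiedMeasure
  infer_instance

lemma isStratifiedSample_eval (hm : 0 < m) :
    IsStratifiedSample (stratifiedMeasure d m) (fun i ω => ω i) := by
  have := isProbabilityMeasure_cond_subcube (d := d) hm
  exact ⟨measurable_pi_apply, iIndepFun_pi (X := fun _ x => x) fun i => aemeasurable_id,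
    fun i => (measurePreserving_eval _ i).map_eq⟩

/-- Stratified sampling on the canonical probability space, as an algorithm. -/
noncomputable def stratifiedAlgorithm (hm : 0 < m) (hn : m ^ d ≤ n) (p : ℝ≥0∞) :
    MCAlgorithm d n (sobolevSpace d p) where
  Ω := (Fin d → Fin m) → (Fin d → ℝ)
  P := stratifiedMeasure d m
  isProb := isProbabilityMeasure_stratifiedMeasure hm
  node := stratifiedNode
  output _ := stratifiedOutput d m
  measurable_error f hf := by
    have hmeas := (continuous_comp_cubeProj hf.1).measurable
    simp only [stratifiedOutput_collect hn, stratified]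
    have hterm (i : Fin d → Fin m) : Measurable
        fun ω : (Fin d → Fin m) → (Fin d → ℝ) => f (cubeProj d (ω i)) :=
      hmeas.comp (measurable_pi_apply i)
    exact (((Finset.measurable_fun_sum _ fun i _ => hterm i).const_mul _).sub_const _).abs

lemma stratifiedAlgorithm_isApproximating (hm : 0 < m) (hn : m ^ d ≤ n) (p : ℝ≥0∞)
    {B : Set ((Fin d → ℝ) → ℝ)} {ε δ : ℝ}
    (h : IsApproximating (stratifiedMeasure d m) (stratified fun i ω => ω i) B ε δ) :
    IsApproximating (stratifiedAlgorithm hm hn p).P (stratifiedAlgorithm hm hn p).run B ε δ := by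
  refine fun f hf => (measure_mono_ae ?_).trans (h f hf)
  filter_upwards [(isStratifiedSample_eval hm).ae_stratified_congr (eqOn_comp_cubeProj f)]
    with ω hω
  have hrun : (stratifiedAlgorithm hm hn p).run ω f = stratified (fun i ω => ω i) ω f :=
    (stratifiedOutput_collect hn ω f).trans hω.symm
  intro (hlt : ε < |_ - _|)
  rwa [hrun] at hlt

end Algorithm

theorem eProb_asympLE {d : ℕ} (hd : 1 ≤ d) {p : ℝ≥0∞} (hp : (d : ℝ≥0∞) < p) :
    AsympLE (eProb d p) (fun n δ => ENNReal.ofReal (rate d (min p 2).toReal n δ)) := by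
  obtain ⟨c, hc, hupper⟩ := exists_stratified_isApproximating hd hp
  refine ⟨1, 1 / 2, by norm_num, c, hc, fun n hn δ hδ => ?_⟩
  have hm := gridSize_pos d hn
  have := isProbabilityMeasure_stratifiedMeasure (d := d) hm
  have hrate := rate_pos d (min p 2).toReal hn (δ := δ) ⟨hδ.1, by linarith [hδ.2]⟩
  simp only
  rw [← ENNReal.ofReal_mul hc.le]
  exact iInf₂_le (c * rate d (min p 2).toReal n δ) ⟨by positivity,
    stratifiedAlgorithm hm (gridSize_pow_le hd n) p,
    stratifiedAlgorithm_isApproximating hm _ p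
      (hupper n hn δ hδ _ _ _ (isStratifiedSample_eval hm))⟩

/-! ### Anti-concentration of sums of random signs -/

section RandomSigns

open scoped Finset

lemma sum_le_two_mul_sum_filter_lt {α : Type*} {s : Finset α} {x : α → ℝ} {θ : ℝ} (hθ0 : 0 ≤ θ)
    (hθ : 2 * (#s * θ) ≤ ∑ i ∈ s, x i) : ∑ i ∈ s, x i ≤ 2 * ∑ i ∈ s with θ < x i, x i := by
  have hsmall : ∑ i ∈ s with ¬ θ < x i, x i ≤ #s * θ :=
    calc ∑ i ∈ s with ¬ θ < x i, x i ≤ #{i ∈ s | ¬ θ < x i} • θ :=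
          Finset.sum_le_card_nsmul _ _ _ fun i hi => not_lt.1 (Finset.mem_filter.1 hi).2
      _ ≤ #s * θ := by
          rw [nsmul_eq_mul]
          gcongr
          exact Finset.filter_subset _ _
  have hsplit := Finset.sum_filter_add_sum_filter_not s (fun i => θ < x i) x
  linarith

lemma paley_zygmund {α : Type*} {s : Finset α} {x : α → ℝ} (hx : ∀ i ∈ s, 0 ≤ x i) {θ : ℝ}
    (hθ0 : 0 ≤ θ) (hθ : 2 * (#s * θ) ≤ ∑ i ∈ s, x i) :
    (∑ i ∈ s, x i) ^ 2 ≤ 4 * (#{i ∈ s | θ < x i} * ∑ i ∈ s, x i ^ 2) :=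
  calc (∑ i ∈ s, x i) ^ 2 ≤ (2 * ∑ i ∈ s with θ < x i, x i) ^ 2 :=
        pow_le_pow_left₀ (Finset.sum_nonneg hx) (sum_le_two_mul_sum_filter_lt hθ0 hθ) 2
    _ = 4 * (∑ i ∈ s with θ < x i, x i) ^ 2 := by ring
    _ ≤ 4 * (#{i ∈ s | θ < x i} * ∑ i ∈ s with θ < x i, x i ^ 2) := by
        gcongr
        exact sq_sum_le_card_mul_sum_sq
    _ ≤ 4 * (#{i ∈ s | θ < x i} * ∑ i ∈ s, x i ^ 2) := by
        gcongr
        exact Finset.filter_subset _ _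

lemma one_add_sq_div_two_le_cosh (l : ℝ) : 1 + l ^ 2 / 2 ≤ Real.cosh l := by
  have hnonneg (k : ℕ) : 0 ≤ l ^ (2 * k) / ((2 * k).factorial : ℝ) :=
    div_nonneg ((even_two_mul k).pow_nonneg l) (Nat.cast_nonneg _)
  simpa [Finset.sum_range_succ] using
    sum_le_hasSum (Finset.range 2) (fun k _ => hnonneg k) (Real.hasSum_cosh l)

lemma exp_sq_div_four_le_cosh {l : ℝ} (hl : l ^ 2 ≤ 1) : Real.exp (l ^ 2 / 4) ≤ Real.cosh l := by
  refine le_trans ?_ (one_add_sq_div_two_le_cosh l)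
  refine (Real.exp_bound_div_one_sub_of_interval (by positivity) (by linarith)).trans ?_
  rw [div_le_iff₀ (by linarith)]
  nlinarith [sq_nonneg l]

/-- The sign `±1` encoded by a Boolean. -/
noncomputable def sgn (b : Bool) : ℝ := if b then 1 else -1

lemma sgn_not (b : Bool) : sgn (!b) = -sgn b := by cases b <;> simp [sgn]

lemma sum_exp_mul_sgn (l : ℝ) : ∑ b, Real.exp (l * sgn b) = 2 * Real.cosh l := by
  rw [Fintype.sum_bool, Real.cosh_eq]
  simp [sgn]
  ring

variable {ι : Type*} [Fintype ι] [DecidableEq ι]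

lemma sum_exp_mul_sum_sgn (U : Finset ι) (l : ℝ) :
    ∑ η : ι → Bool, Real.exp (l * ∑ i ∈ U, sgn (η i)) =
      2 ^ Fintype.card ι * Real.cosh l ^ #U := by
  have hprod (η : ι → Bool) : Real.exp (l * ∑ i ∈ U, sgn (η i)) =
      ∏ i, if i ∈ U then Real.exp (l * sgn (η i)) else 1 := by
    rw [Finset.mul_sum, Real.exp_sum, Finset.prod_ite_mem, Finset.univ_inter]
  have hcoord (i : ι) : ∑ b, (if i ∈ U then Real.exp (l * sgn b) else 1) =
      2 * if i ∈ U then Real.cosh l else 1 := by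
    split_ifs
    · exact sum_exp_mul_sgn l
    · norm_num
  have hswap := Finset.prod_univ_sum (fun _ : ι => (Finset.univ : Finset Bool))
    (fun i b => if i ∈ U then Real.exp (l * sgn b) else 1)
  rw [Fintype.piFinset_univ] at hswap
  simp_rw [hprod, ← hswap, hcoord]
  rw [Finset.prod_mul_distrib, Finset.prod_const, Finset.card_univ, Finset.prod_ite_mem,
    Finset.univ_inter, Finset.prod_const]

lemma mul_div_eight_lt_of_cosh_pow_lt {M : ℕ} {l S : ℝ} (hl : l ∈ Ioc (0 : ℝ) 1)
    (hM : 8 ≤ M * l ^ 2) (h : Real.cosh l ^ M / 2 < Real.exp (l * S)) : M * l / 8 < S := by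
  have hcosh : Real.exp (M * (l ^ 2 / 4)) ≤ Real.cosh l ^ M := by
    rw [Real.exp_nat_mul]
    gcongr
    exact exp_sq_div_four_le_cosh (pow_le_one₀ hl.1.le hl.2)
  have hexp : Real.exp (M * (l ^ 2 / 4) - 1) < Real.exp (l * S) := by
    refine lt_of_le_of_lt ?_ h
    rw [Real.exp_sub]
    have htwo : 2 ≤ Real.exp 1 := by linarith [Real.add_one_le_exp (1 : ℝ)]
    gcongr
  rw [Real.exp_lt_exp] at hexp
  refine lt_of_mul_lt_mul_left ?_ hl.1.le
  linarith

lemma le_card_cosh_pow_lt_exp (U : Finset ι) (l : ℝ) :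
    (2 : ℝ) ^ Fintype.card ι / 4 * Real.exp (-(2 * l ^ 2 * #U)) ≤
      #{η : ι → Bool | Real.cosh l ^ #U / 2 < Real.exp (l * ∑ i ∈ U, sgn (η i))} := by
  set G := #{η : ι → Bool | Real.cosh l ^ #U / 2 < Real.exp (l * ∑ i ∈ U, sgn (η i))}
  have hmean := sum_exp_mul_sum_sgn U l
  have hsecond : ∑ η : ι → Bool, Real.exp (l * ∑ i ∈ U, sgn (η i)) ^ 2 ≤
      2 ^ Fintype.card ι * Real.exp (2 * l ^ 2 * #U) := by
    simp_rw [← Real.exp_nat_mul, ← mul_assoc]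
    rw [sum_exp_mul_sum_sgn]
    gcongr
    calc Real.cosh ((2 : ℕ) * l) ^ #U ≤ Real.exp (((2 : ℕ) * l) ^ 2 / 2) ^ #U := by
          gcongr
          exact Real.cosh_le_exp_half_sq _
      _ = Real.exp (2 * l ^ 2 * #U) := by
          rw [← Real.exp_nat_mul]
          push_cast
          ring_nf
  have hcount : ((2 : ℝ) ^ Fintype.card ι) ^ 2 ≤
      4 * (G * (2 ^ Fintype.card ι * Real.exp (2 * l ^ 2 * #U))) :=
    calc ((2 : ℝ) ^ Fintype.card ι) ^ 2 ≤ (2 ^ Fintype.card ι * Real.cosh l ^ #U) ^ 2 := by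
          gcongr
          exact le_mul_of_one_le_right (by positivity) (one_le_pow₀ (Real.one_le_cosh l))
      _ = (∑ η : ι → Bool, Real.exp (l * ∑ i ∈ U, sgn (η i))) ^ 2 := by rw [hmean]
      _ ≤ 4 * (G * ∑ η : ι → Bool, Real.exp (l * ∑ i ∈ U, sgn (η i)) ^ 2) := by
          refine paley_zygmund (fun η _ => (Real.exp_pos _).le)
            (by have := Real.cosh_pos l; positivity) (le_of_eq ?_)
          rw [hmean, Finset.card_univ, Fintype.card_fun, Fintype.card_bool]
          push_cast
          ring
      _ ≤ 4 * (G * (2 ^ Fintype.card ι * Real.exp (2 * l ^ 2 * #U))) := by gcongr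
  rw [Real.exp_neg, ← div_eq_mul_inv, div_le_iff₀ (Real.exp_pos _)]
  refine le_of_mul_le_mul_left ?_ (by positivity : (0 : ℝ) < 2 ^ Fintype.card ι)
  linarith

lemma le_card_lt_sum_sgn (U : Finset ι) {l : ℝ} (hl : l ∈ Ioc (0 : ℝ) 1)
    (hU : 8 ≤ #U * l ^ 2) :
    (2 : ℝ) ^ Fintype.card ι / 4 * Real.exp (-(2 * l ^ 2 * #U)) ≤
      #{η : ι → Bool | #U * l / 8 < ∑ i ∈ U, sgn (η i)} := by
  refine (le_card_cosh_pow_lt_exp U l).trans (Nat.cast_le.2 (Finset.card_le_card ?_))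
  exact Finset.monotone_filter_right _ fun η _ => mul_div_eight_lt_of_cosh_pow_lt hl hU

lemma le_card_lt_abs_add_sum_sgn (U : Finset ι) {l : ℝ} (hl : l ∈ Ioc (0 : ℝ) 1)
    (hU : 8 ≤ #U * l ^ 2) (r : ℝ) :
    (2 : ℝ) ^ Fintype.card ι / 4 * Real.exp (-(2 * l ^ 2 * #U)) ≤
      #{η : ι → Bool | #U * l / 8 < |r + ∑ i ∈ U, sgn (η i)|} := by
  refine (le_card_lt_sum_sgn U hl hU).trans (Nat.cast_le.2 ?_)
  rcases le_total 0 r with hr | hr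
  · refine Finset.card_le_card (Finset.monotone_filter_right _ fun η _ hη => ?_)
    exact hη.trans_le ((le_add_of_nonneg_left hr).trans (le_abs_self _))
  · refine Finset.card_le_card_of_injOn (fun η i => !η i) (fun η hη => ?_) fun η _ η' _ h => ?_
    · rw [Finset.mem_coe, Finset.mem_filter] at hη ⊢
      refine ⟨Finset.mem_univ _, hη.2.trans_le (le_trans ?_ (neg_le_abs _))⟩
      simp_rw [sgn_not, Finset.sum_neg_distrib]
      linarith
    · exact funext fun i => Bool.not_inj (congrFun h i)

end RandomSigns

/-! ### Adaptive information about random signs -/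

section Adaptive

open scoped Finset

/-- The combination of the functions `ψ i` with the signs `ε i`; with random signs, these are the
hard instances of the lower bound. -/
noncomputable def signedSum {ι : Type*} [Fintype ι] {d : ℕ} (ψ : ι → (Fin d → ℝ) → ℝ)
    (ε : ι → Bool) (x : Fin d → ℝ) : ℝ :=
  ∑ i, sgn (ε i) * ψ i x

variable {ι : Type*} [DecidableEq ι]

lemma involutive_exchange_piecewise {κ : Type*} {J : (ι → κ) → Finset ι}
    (hJ : ∀ ε ε' : ι → κ, (∀ i ∈ J ε, ε' i = ε i) → J ε' = J ε) :
    Function.Involutive fun z : (ι → κ) × (ι → κ) =>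
      ((J z.1).piecewise z.1 z.2, (J z.1).piecewise z.2 z.1) := by
  rintro ⟨ε, η⟩
  have hJε : J ((J ε).piecewise ε η) = J ε :=
    hJ _ _ fun i hi => Finset.piecewise_eq_of_mem _ _ _ hi
  have hpiecewise (ξ ζ : ι → κ) :
      (J ((J ε).piecewise ε η)).piecewise ξ ζ = (J ε).piecewise ξ ζ := by
    ext i
    simp only [Finset.piecewise, hJε]
  simp only [hpiecewise]
  ext i <;> by_cases hi : i ∈ J ε <;> simp [hi]

variable [Fintype ι]

/-- If the set `J ε` of revealed coordinates is determined by the revealed values themselves, then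
exchanging the unrevealed coordinates of two independent uniform vectors is measure preserving;
hence it suffices to count conditionally on the revealed values. -/
lemma le_card_filter_of_forall_piecewise {κ : Type*} [Fintype κ] [Nonempty κ]
    {J : (ι → κ) → Finset ι} (hJ : ∀ ε ε' : ι → κ, (∀ i ∈ J ε, ε' i = ε i) → J ε' = J ε)
    {F : (ι → κ) → Prop} [DecidablePred F] {r : ℝ}
    (h : ∀ ε, r ≤ #{η | F ((J ε).piecewise ε η)}) : r ≤ #{ε | F ε} := by
  have hexchange : ∑ z : (ι → κ) × (ι → κ), (if F z.1 then (1 : ℝ) else 0) =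
      ∑ z : (ι → κ) × (ι → κ), (if F ((J z.1).piecewise z.1 z.2) then (1 : ℝ) else 0) :=
    (Equiv.sum_comp ((involutive_exchange_piecewise hJ).toPerm _)
      fun z => if F z.1 then (1 : ℝ) else 0).symm
  rw [Fintype.sum_prod_type_right, Fintype.sum_prod_type] at hexchange
  simp only [Finset.sum_const, nsmul_eq_mul, Finset.sum_boole] at hexchange
  have hsum : #(Finset.univ : Finset (ι → κ)) * r ≤
      ∑ ε, (#{η | F ((J ε).piecewise ε η)} : ℝ) := by
    rw [← nsmul_eq_mul]
    exact Finset.card_nsmul_le_sum _ _ _ fun ε _ => h ε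
  rw [← hexchange] at hsum
  exact le_of_mul_le_mul_left hsum (by exact_mod_cast Finset.univ_nonempty.card_pos)

lemma sum_sgn_piecewise (J : Finset ι) (ε η : ι → Bool) :
    ∑ i, sgn (J.piecewise ε η i) = ∑ i ∈ J, sgn (ε i) + ∑ i ∈ Jᶜ, sgn (η i) := by
  rw [← Finset.sum_add_sum_compl J]
  congr 1
  · exact Finset.sum_congr rfl fun i hi => by rw [Finset.piecewise_eq_of_mem _ _ _ hi]
  · exact Finset.sum_congr rfl fun i hi => by
      rw [Finset.piecewise_eq_of_notMem _ _ _ (Finset.mem_compl.1 hi)]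

variable {d : ℕ} {ψ : ι → (Fin d → ℝ) → ℝ} {node : List ℝ → cube d} {n : ℕ}

open Classical in
/-- The indices `i` whose sign is revealed by the first `n` function values, that is, for which
`ψ i` is non-zero at one of the first `n` sample points. -/
noncomputable def touched (ψ : ι → (Fin d → ℝ) → ℝ) (node : List ℝ → cube d) (n : ℕ)
    (ε : ι → Bool) : Finset ι :=
  (Finset.range n).biUnion fun l => {i | ψ i (node (collect node (signedSum ψ ε) l)) ≠ 0}

lemma card_touched_le (hψ : Pairwise fun i j => Disjoint (ψ i).support (ψ j).support)
    (node : List ℝ → cube d) (n : ℕ) (ε : ι → Bool) : #(touched ψ node n ε) ≤ n := by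
  classical
  refine (Finset.card_biUnion_le_card_mul _ _ 1 fun l _ => ?_).trans (by simp)
  refine Finset.card_le_one.2 fun i hi j hj => ?_
  by_contra hij
  exact Set.disjoint_left.1 (hψ hij) (Finset.mem_filter.1 hi).2 (Finset.mem_filter.1 hj).2

lemma collect_congr_of_eqOn_touched {ε ε' : ι → Bool}
    (h : ∀ i ∈ touched ψ node n ε, ε' i = ε i) {l : ℕ} (hl : l ≤ n) :
    collect node (signedSum ψ ε') l = collect node (signedSum ψ ε) l := by
  induction l with
  | zero => rfl
  | succ l ih =>
    rw [collect, collect, ih (by omega)]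
    congr 2
    refine Finset.sum_congr rfl fun i _ => ?_
    by_cases hi : ψ i (node (collect node (signedSum ψ ε) l)) = 0
    · rw [hi, mul_zero, mul_zero]
    · rw [h i]
      exact Finset.mem_biUnion.2 ⟨l, Finset.mem_range.2 (by omega),
        Finset.mem_filter.2 ⟨Finset.mem_univ _, hi⟩⟩

lemma touched_congr {ε ε' : ι → Bool} (h : ∀ i ∈ touched ψ node n ε, ε' i = ε i) :
    touched ψ node n ε' = touched ψ node n ε := by
  unfold touched
  refine Finset.biUnion_congr rfl fun l hl => ?_
  rw [collect_congr_of_eqOn_touched h (Finset.mem_range.1 hl).le]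

lemma abs_sub_mul_add_eq {y I b s : ℝ} (hI : 0 < I) :
    |y - I * (b + s)| = I * |b - y / I + s| := by
  rw [abs_sub_comm, ← abs_of_pos hI, ← abs_mul, abs_of_pos hI]
  congr 1
  field_simp
  ring

lemma le_card_lt_abs_output_sub (hψ : Pairwise fun i j => Disjoint (ψ i).support (ψ j).support)
    (node : List ℝ → cube d) (output : List ℝ → ℝ) {I l : ℝ} (hI : 0 < I)
    (hl : l ∈ Ioc (0 : ℝ) 1) (hn : 8 ≤ ((Fintype.card ι : ℝ) - n) * l ^ 2) :
    (2 : ℝ) ^ Fintype.card ι / 4 * Real.exp (-(2 * l ^ 2 * Fintype.card ι)) ≤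
      #{ε : ι → Bool | I * (((Fintype.card ι : ℝ) - n) * l / 8) <
        |output (collect node (signedSum ψ ε) n) - I * ∑ i, sgn (ε i)|} := by
  refine le_card_filter_of_forall_piecewise (J := touched ψ node n)
    (fun ε ε' h => touched_congr h) fun ε => ?_
  set J := touched ψ node n ε
  set y := output (collect node (signedSum ψ ε) n) with hy
  set b := ∑ i ∈ J, sgn (ε i) with hb
  have hl0 := hl.1
  have hcard_le : (#Jᶜ : ℝ) ≤ Fintype.card ι := by exact_mod_cast Finset.card_le_univ _
  have hle_card : (Fintype.card ι : ℝ) - n ≤ #Jᶜ := by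
    have hJ : (#J : ℝ) ≤ n := by exact_mod_cast card_touched_le hψ node n ε
    rw [Finset.card_compl, Nat.cast_sub (Finset.card_le_univ J)]
    linarith
  have hcount := le_card_lt_abs_add_sum_sgn Jᶜ hl
    (hn.trans (mul_le_mul_of_nonneg_right hle_card (sq_nonneg l))) (b - y / I)
  refine le_trans (by gcongr) (hcount.trans (Nat.cast_le.2 (Finset.card_le_card ?_)))
  refine Finset.monotone_filter_right _ fun η _ hη => ?_
  rw [collect_congr_of_eqOn_touched (fun i hi => Finset.piecewise_eq_of_mem _ _ _ hi) le_rfl,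
    ← hy, sum_sgn_piecewise, ← hb, abs_sub_mul_add_eq hI]
  refine mul_lt_mul_of_pos_left (lt_of_le_of_lt ?_ hη) hI
  gcongr

end Adaptive

open scoped Finset in
lemma le_sum_measureReal {Ω α : Type*} [MeasurableSpace Ω] {P : Measure Ω}
    [IsProbabilityMeasure P] [Fintype α] {E : α → Set Ω} (hE : ∀ a, MeasurableSet (E a))
    [∀ ω, DecidablePred fun a => ω ∈ E a] {r : ℝ} (h : ∀ ω, r ≤ #{a | ω ∈ E a}) :
    r ≤ ∑ a, P.real (E a) := by
  have hint (a : α) : Integrable ((E a).indicator (1 : Ω → ℝ)) P :=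
    (integrable_const 1).indicator (hE a)
  calc r = ∫ _, r ∂P := by simp
    _ ≤ ∫ ω, ∑ a, (E a).indicator (1 : Ω → ℝ) ω ∂P := by
        refine integral_mono (integrable_const r) (integrable_finsetSum _ fun a _ => hint a)
          fun ω => (h ω).trans_eq ?_
        simp [Set.indicator_apply]
    _ = ∑ a, P.real (E a) := by
        rw [integral_finsetSum _ fun a _ => hint a]
        simp only [integral_indicator_one (hE _)]

theorem lt_of_isApproximating {ι : Type*} [Fintype ι] {d n : ℕ} {ψ : ι → (Fin d → ℝ) → ℝ}
    (hψ : Pairwise fun i j => Disjoint (ψ i).support (ψ j).support)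
    {I : ℝ} (hI : 0 < I) (hint : ∀ ε, integralCube d (signedSum ψ ε) = I * ∑ i, sgn (ε i))
    {W B : Set ((Fin d → ℝ) → ℝ)} (hBW : B ⊆ W) (hB : ∀ ε, signedSum ψ ε ∈ B)
    (A : MCAlgorithm d n W) {e δ l : ℝ} (hA : IsApproximating A.P A.run B e δ) (hδ0 : 0 ≤ δ)
    (hl : l ∈ Ioc (0 : ℝ) 1) (hn : 8 ≤ ((Fintype.card ι : ℝ) - n) * l ^ 2)
    (hδ : δ < Real.exp (-(2 * l ^ 2 * Fintype.card ι)) / 4) :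
    I * (((Fintype.card ι : ℝ) - n) * l / 8) < e := by
  classical
  by_contra! he
  let failure (ε : ι → Bool) : Set A.Ω :=
    {ω | e < |A.run ω (signedSum ψ ε) - integralCube d (signedSum ψ ε)|}
  have hmeas (ε : ι → Bool) : MeasurableSet (failure ε) :=
    measurableSet_lt measurable_const (A.measurable_error _ (hBW (hB ε)))
  have hlower : (2 : ℝ) ^ Fintype.card ι / 4 * Real.exp (-(2 * l ^ 2 * Fintype.card ι)) ≤
      ∑ ε, A.P.real (failure ε) := by
    refine le_sum_measureReal hmeas fun ω =>
      (le_card_lt_abs_output_sub hψ (A.node ω) (A.output ω) hI hl hn).trans (Nat.cast_le.2 ?_)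
    refine Finset.card_le_card (Finset.monotone_filter_right _ fun ε _ hε => ?_)
    change e < |_ - integralCube d _|
    rw [hint]
    exact he.trans_lt hε
  have hupper : ∑ ε, A.P.real (failure ε) ≤ 2 ^ Fintype.card ι * δ := by
    refine (Finset.sum_le_card_nsmul _ _ δ fun ε _ =>
      ENNReal.toReal_le_of_le_ofReal hδ0 (hA _ (hB ε))).trans_eq ?_
    rw [nsmul_eq_mul, Finset.card_univ, Fintype.card_fun, Fintype.card_bool, Nat.cast_pow,
      Nat.cast_ofNat]
  have hgap := mul_lt_mul_of_pos_left hδ (by positivity : (0 : ℝ) < 2 ^ Fintype.card ι)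
  linarith

/-! ### Signed sums of bumps in the Sobolev ball -/

section SobolevBall

variable {d : ℕ} {p : ℝ≥0∞}

lemma isWeakGradient_fderiv {f : (Fin d → ℝ) → ℝ} (hf : ContDiff ℝ 1 f) :
    IsWeakGradient f fun j x => fderiv ℝ f x (Pi.single j 1) := by
  intro j
  have hcont : Continuous fun x => fderiv ℝ f x (Pi.single j 1) :=
    (hf.continuous_fderiv one_ne_zero).clm_apply continuous_const
  refine ⟨hcont.locallyIntegrable.locallyIntegrableOn _, fun φ hφ hφc hφs => ?_⟩
  have hφcont : Continuous fun x => fderiv ℝ φ x (Pi.single j 1) :=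
    (hφ.continuous_fderiv (by simp)).clm_apply continuous_const
  have hφs' : tsupport (fun x => fderiv ℝ φ x (Pi.single j 1)) ⊆ interior (cube d) :=
    (tsupport_fderiv_apply_subset ℝ _).trans hφs
  rw [setIntegral_eq_integral_of_forall_compl_eq_zero fun x hx => by
      rw [eq_zero_of_tsupport_subset_interior hφs' hx, mul_zero],
    setIntegral_eq_integral_of_forall_compl_eq_zero fun x hx => by
      rw [eq_zero_of_tsupport_subset_interior hφs hx, mul_zero]]
  exact integral_mul_fderiv_eq_neg_fderiv_mul_of_integrable
    ((hcont.mul hφ.continuous).integrable_of_hasCompactSupport hφc.mul_left)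
    ((hf.continuous.mul hφcont).integrable_of_hasCompactSupport (hφc.fderiv_apply ℝ _).mul_left)
    ((hf.continuous.mul hφ.continuous).integrable_of_hasCompactSupport hφc.mul_left)
    (fun x _ => hf.differentiable one_ne_zero x) (fun x _ => hφ.differentiable (by simp) x)

lemma eLpNorm_restrict_cube_le {u : (Fin d → ℝ) → ℝ} {C : ℝ} (hu : ∀ x, |u x| ≤ C) :
    eLpNorm u p (volume.restrict (cube d)) ≤ ENNReal.ofReal C := by
  simpa using eLpNorm_le_of_ae_bound (p := p) (μ := volume.restrict (cube d))
    (Filter.Eventually.of_forall hu)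

lemma sobolevNorm_le_one (hp : 1 ≤ p) {f : (Fin d → ℝ) → ℝ} {g : Fin d → (Fin d → ℝ) → ℝ}
    (hf : eLpNorm f p (volume.restrict (cube d)) ≤ ((d : ℝ≥0∞) + 1)⁻¹)
    (hg : ∀ j, eLpNorm (g j) p (volume.restrict (cube d)) ≤ ((d : ℝ≥0∞) + 1)⁻¹) :
    sobolevNorm p f g ≤ 1 := by
  have hone : ((d : ℝ≥0∞) + 1)⁻¹ ≤ 1 := ENNReal.inv_le_one.2 le_add_self
  unfold sobolevNorm
  split_ifs with hpt
  · subst hpt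
    exact max_le (hf.trans hone) (iSup_le fun j => (hg j).trans hone)
  · have hp1 : 1 ≤ p.toReal := by
      rw [← ENNReal.toReal_one]
      exact ENNReal.toReal_mono hpt hp
    have hpow {a : ℝ≥0∞} (ha : a ≤ ((d : ℝ≥0∞) + 1)⁻¹) : a ^ p.toReal ≤ ((d : ℝ≥0∞) + 1)⁻¹ :=
      (ENNReal.rpow_le_self_of_le_one (ha.trans hone) hp1).trans ha
    refine ENNReal.rpow_le_one ?_ (by positivity)
    calc _ ≤ ((d : ℝ≥0∞) + 1)⁻¹ + ∑ _j : Fin d, ((d : ℝ≥0∞) + 1)⁻¹ :=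
          add_le_add (hpow hf) (Finset.sum_le_sum fun j _ => hpow (hg j))
      _ = ((d : ℝ≥0∞) + 1) * ((d : ℝ≥0∞) + 1)⁻¹ := by
          rw [Finset.sum_const, Finset.card_univ, Fintype.card_fin, nsmul_eq_mul]
          ring
      _ = 1 := ENNReal.mul_inv_cancel (by simp) (by simp)

lemma mem_sobolevBall_of_contDiff (hp : 1 ≤ p) {f : (Fin d → ℝ) → ℝ} (hf : ContDiff ℝ 1 f)
    (hbound : ∀ x, |f x| ≤ ((d : ℝ) + 1)⁻¹)
    (hderiv : ∀ x j, |fderiv ℝ f x (Pi.single j 1)| ≤ ((d : ℝ) + 1)⁻¹) : f ∈ sobolevBall d p := by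
  have hC : ENNReal.ofReal ((d : ℝ) + 1)⁻¹ = ((d : ℝ≥0∞) + 1)⁻¹ := by
    rw [ENNReal.ofReal_inv_of_pos (by positivity), ENNReal.ofReal_add (by positivity) zero_le_one,
      ENNReal.ofReal_natCast, ENNReal.ofReal_one]
  exact ⟨hf.continuous.continuousOn, _, isWeakGradient_fderiv hf, sobolevNorm_le_one hp
    (hC ▸ eLpNorm_restrict_cube_le hbound)
    fun j => hC ▸ eLpNorm_restrict_cube_le fun x => hderiv x j⟩

lemma sobolevBall_subset_sobolevSpace : sobolevBall d p ⊆ sobolevSpace d p :=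
  fun _ ⟨hf, g, hg, hnorm⟩ => ⟨hf, g, hg, hnorm.trans_lt ENNReal.one_lt_top⟩

end SobolevBall

section SignedSum

variable {ι : Type*} [Fintype ι] {d : ℕ} {ψ : ι → (Fin d → ℝ) → ℝ}

lemma abs_sgn (b : Bool) : |sgn b| = 1 := by cases b <;> simp [sgn]

lemma abs_signedSum_le (hψ : Pairwise fun i j => Disjoint (ψ i).support (ψ j).support) {C : ℝ}
    (hC : 0 ≤ C) {x : Fin d → ℝ} (h : ∀ i, |ψ i x| ≤ C) (ε : ι → Bool) :
    |signedSum ψ ε x| ≤ C := by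
  unfold signedSum
  by_cases hx : ∃ i, ψ i x ≠ 0
  · obtain ⟨i, hi⟩ := hx
    have hother (j : ι) (hj : j ≠ i) : ψ j x = 0 := by
      by_contra hne
      exact Set.disjoint_left.1 (hψ hj) hne hi
    rw [Fintype.sum_eq_single i fun j hj => by rw [hother j hj, mul_zero], abs_mul, abs_sgn,
      one_mul]
    exact h i
  · push Not at hx
    simpa only [hx, mul_zero, Finset.sum_const_zero, abs_zero] using hC

lemma contDiff_signedSum {n : WithTop ℕ∞} (hψ : ∀ i, ContDiff ℝ n (ψ i)) (ε : ι → Bool) :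
    ContDiff ℝ n (signedSum ψ ε) :=
  ContDiff.sum fun i _ => contDiff_const.mul (hψ i)

lemma fderiv_signedSum (hψ : ∀ i, Differentiable ℝ (ψ i)) (ε : ι → Bool) (x v : Fin d → ℝ) :
    fderiv ℝ (signedSum ψ ε) x v = signedSum (fun i x => fderiv ℝ (ψ i) x v) ε x := by
  have hderiv : HasFDerivAt (signedSum ψ ε) (∑ i, sgn (ε i) • fderiv ℝ (ψ i) x) x :=
    HasFDerivAt.fun_sum fun i _ => (hψ i x).hasFDerivAt.const_mul _
  rw [hderiv.fderiv]
  simp [signedSum]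

lemma integralCube_signedSum (hψ : ∀ i, IntegrableOn (ψ i) (cube d)) {I : ℝ}
    (hI : ∀ i, integralCube d (ψ i) = I) (ε : ι → Bool) :
    integralCube d (signedSum ψ ε) = I * ∑ i, sgn (ε i) := by
  unfold integralCube at hI ⊢
  unfold signedSum
  rw [integral_finsetSum _ fun i _ => (hψ i).const_mul _]
  simp_rw [integral_const_mul, hI]
  rw [← Finset.sum_mul, mul_comm]

end SignedSum

section Bump

variable {d k : ℕ} {φ : (Fin d → ℝ) → ℝ}

lemma pairwise_disjoint_of_tsupport_subset_subcube {ψ : (Fin d → Fin k) → (Fin d → ℝ) → ℝ}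
    (hψ : ∀ i, tsupport (ψ i) ⊆ interior (subcube i)) :
    Pairwise fun i j => Disjoint (ψ i).support (ψ j).support := fun i j hij =>
  (pairwise_disjoint_subcube hij).mono
    ((subset_tsupport _).trans ((hψ i).trans interior_subset))
    ((subset_tsupport _).trans ((hψ j).trans interior_subset))

lemma fderiv_subcubeBump (hφ : Differentiable ℝ φ) (i : Fin d → Fin k) (x : Fin d → ℝ) :
    fderiv ℝ (subcubeBump φ i) x = (k : ℝ) • fderiv ℝ φ ((k : ℝ) • (x - corner i)) := by
  have hzoom : HasFDerivAt (fun x : Fin d → ℝ => (k : ℝ) • (x - corner i))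
      ((k : ℝ) • ContinuousLinearMap.id ℝ (Fin d → ℝ)) x :=
    ((hasFDerivAt_id x).sub_const _).const_smul (k : ℝ)
  refine (HasFDerivAt.comp x (hφ _).hasFDerivAt hzoom).fderiv.trans ?_
  ext v
  simp

lemma tsupport_const_smul_subcubeBump_subset (hφ : tsupport φ ⊆ interior (cube d)) (c : ℝ)
    (i : Fin d → Fin k) : tsupport (c • subcubeBump φ i) ⊆ interior (subcube i) :=
  (closure_mono (Function.support_const_smul_subset c _)).trans
    (tsupport_subcubeBump_subset hφ i)

lemma signedSum_subcubeBump_mem_sobolevBall {p : ℝ≥0∞} (hp : 1 ≤ p) (hk : 0 < k)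
    (hφ : IsCubeBump φ) {D κ : ℝ} (hD : ∀ x, ‖fderiv ℝ φ x‖ ≤ D) (hκ0 : 0 ≤ κ)
    (hκ : κ ≤ ((d : ℝ) + 1)⁻¹) (hκD : κ * D ≤ ((d : ℝ) + 1)⁻¹) (ε : (Fin d → Fin k) → Bool) :
    signedSum (fun i => (κ / k) • subcubeBump φ i) ε ∈ sobolevBall d p := by
  have hk1 : (1 : ℝ) ≤ k := by exact_mod_cast hk
  have hsupp := tsupport_const_smul_subcubeBump_subset (k := k) hφ.tsupport_subset (κ / k)
  have hdiff (i : Fin d → Fin k) : ContDiff ℝ 1 ((κ / k) • subcubeBump φ i) :=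
    contDiff_const.smul (contDiff_subcubeBump (hφ.contDiff.of_le (by simp)) i)
  refine mem_sobolevBall_of_contDiff hp (contDiff_signedSum hdiff ε) (fun x => ?_) fun x j => ?_
  · refine abs_signedSum_le (pairwise_disjoint_of_tsupport_subset_subcube hsupp) (by positivity)
      (fun i => ?_) ε
    obtain ⟨hnonneg, hle_one⟩ := hφ.mem_Icc ((k : ℝ) • (x - corner i))
    rw [Pi.smul_apply, smul_eq_mul, subcubeBump, abs_of_nonneg (by positivity)]
    exact (mul_le_of_le_one_right (by positivity) hle_one).trans
      ((div_le_self hκ0 hk1).trans hκ)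
  · rw [fderiv_signedSum fun i => (hdiff i).differentiable one_ne_zero]
    refine abs_signedSum_le (pairwise_disjoint_of_tsupport_subset_subcube fun i =>
      (tsupport_fderiv_apply_subset ℝ _).trans (hsupp i)) (by positivity) (fun i => ?_) ε
    have hpartial : |fderiv ℝ φ ((k : ℝ) • (x - corner i)) (Pi.single j 1)| ≤ D := by
      refine ((fderiv ℝ φ _).le_opNorm (Pi.single j 1)).trans ?_
      rw [Pi.norm_single, norm_one, mul_one]
      exact hD _
    have hφd : Differentiable ℝ φ := hφ.contDiff.differentiable (by simp)
    have hbd : Differentiable ℝ (subcubeBump φ i) :=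
      (contDiff_subcubeBump hφ.contDiff i).differentiable (by simp)
    rw [fderiv_const_smul (hbd x), fderiv_subcubeBump hφd, smul_smul,
      div_mul_cancel₀ _ (by positivity), smul_apply, smul_eq_mul, abs_mul,
      abs_of_nonneg hκ0]
    exact (mul_le_mul_of_nonneg_left hpartial hκ0).trans hκD

lemma integralCube_smul_subcubeBump (hφ : tsupport φ ⊆ interior (cube d)) (c : ℝ)
    (i : Fin d → Fin k) :
    integralCube d (c • subcubeBump φ i) = c * ((k : ℝ)⁻¹ ^ d * ∫ x, φ x) := by
  have hsupp : tsupport (c • subcubeBump φ i) ⊆ interior (cube d) :=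
    (tsupport_const_smul_subcubeBump_subset hφ c i).trans
      (interior_mono (subcube_subset_cube i))
  rw [integralCube, setIntegral_eq_integral_of_forall_compl_eq_zero fun x hx =>
    eq_zero_of_tsupport_subset_interior hsupp hx, ← integral_subcubeBump i]
  exact integral_const_mul c _

end Bump

/-! ### The lower bound -/

theorem exists_error_lower_bound (d : ℕ) {p : ℝ≥0∞} (hp : 1 ≤ p) :
    ∃ κ : ℝ, 0 < κ ∧ ∀ k n : ℕ, 0 < k → ∀ (A : MCAlgorithm d n (sobolevSpace d p)) (e δ l : ℝ),
      IsApproximating A.P A.run (sobolevBall d p) e δ → 0 ≤ δ → l ∈ Ioc (0 : ℝ) 1 →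
      8 ≤ ((k : ℝ) ^ d - n) * l ^ 2 → δ < Real.exp (-(2 * l ^ 2 * (k : ℝ) ^ d)) / 4 →
      κ * ((k : ℝ) ^ d - n) * l / (k * (k : ℝ) ^ d) < e := by
  obtain ⟨φ, hφ⟩ := exists_isCubeBump d
  have hφc : HasCompactSupport φ := (isCompact_cube d).of_isClosed_subset (isClosed_tsupport φ)
    (hφ.tsupport_subset.trans interior_subset)
  obtain ⟨D, hD⟩ := (hφc.fderiv ℝ).exists_bound_of_continuous
    (hφ.contDiff.continuous_fderiv (by simp))
  have hD0 : 0 ≤ D := (norm_nonneg _).trans (hD 0)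
  have hI := hφ.integral_pos
  set κ : ℝ := ((d : ℝ) + 1)⁻¹ * (D + 1)⁻¹ with hκ
  have hκ0 : 0 < κ := by positivity
  have hκ1 : κ ≤ ((d : ℝ) + 1)⁻¹ :=
    mul_le_of_le_one_right (by positivity) (inv_le_one_of_one_le₀ (by linarith))
  have hκD : κ * D ≤ ((d : ℝ) + 1)⁻¹ := by
    rw [hκ, mul_assoc, ← div_eq_inv_mul (a := D)]
    exact mul_le_of_le_one_right (by positivity) ((div_le_one (by linarith)).2 (by linarith))
  refine ⟨κ * (∫ x, φ x) / 8, by positivity, fun k n hk A e δ l hA hδ0 hl hn hδ => ?_⟩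
  have hcard : (Fintype.card (Fin d → Fin k) : ℝ) = (k : ℝ) ^ d := by simp
  have hcont (i : Fin d → Fin k) : Continuous ((κ / k) • subcubeBump φ i) :=
    (contDiff_subcubeBump hφ.contDiff i).continuous.const_smul (κ / k)
  have herror := lt_of_isApproximating
    (pairwise_disjoint_of_tsupport_subset_subcube
      (tsupport_const_smul_subcubeBump_subset hφ.tsupport_subset (κ / k)))
    (by positivity)
    (integralCube_signedSum (fun i => (hcont i).continuousOn.integrableOn_compact
      (isCompact_cube d)) (integralCube_smul_subcubeBump hφ.tsupport_subset (κ / k)))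
    sobolevBall_subset_sobolevSpace
    (signedSum_subcubeBump_mem_sobolevBall hp hk hφ hD hκ0.le hκ1 hκD) A hA hδ0 hl
    (by rwa [hcard]) (by rwa [hcard])
  rw [hcard, inv_pow] at herror
  refine lt_of_eq_of_lt ?_ herror
  field_simp

lemma exists_grid_of_budget {d n : ℕ} (hd : 1 ≤ d) (hn : 1 ≤ n) :
    ∃ k : ℕ, 0 < k ∧ (k : ℝ) ≤ 4 * (n : ℝ) ^ (1 / (d : ℝ)) ∧
      (k : ℝ) ^ d ∈ Icc (2 * (n : ℝ)) (4 ^ d * n) := by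
  set t := (n : ℝ) ^ (1 / (d : ℝ))
  have ht1 : 1 ≤ t := Real.one_le_rpow (by exact_mod_cast hn) (by positivity)
  have htd : t ^ d = n := rpow_one_div_pow_natCast hd n
  have hlower : 2 * t ≤ (2 * ⌈t⌉₊ : ℕ) := by
    push_cast
    linarith [Nat.le_ceil t]
  have hupper : ((2 * ⌈t⌉₊ : ℕ) : ℝ) ≤ 4 * t := by
    push_cast
    linarith [Nat.ceil_lt_add_one (by linarith : 0 ≤ t)]
  refine ⟨2 * ⌈t⌉₊, by positivity, hupper, ?_, ?_⟩
  · calc 2 * (n : ℝ) ≤ 2 ^ d * n := by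
          gcongr
          exact le_self_pow₀ one_le_two (by omega)
      _ = (2 * t) ^ d := by rw [mul_pow, htd]
      _ ≤ _ := by gcongr
  · calc _ ≤ (4 * t) ^ d := by gcongr
      _ = 4 ^ d * n := by rw [mul_pow, htd]

section Tilt

variable {N δ : ℝ}

/-- The parameter of the exponential moments of a sum of `N` random signs at which the lower bound
`exp (-2 l² N) / 4` for the probability of a deviation of order `N l` still exceeds `δ`. -/
noncomputable def tilt (N δ : ℝ) : ℝ := min 1 √(Real.log δ⁻¹ / (4 * N))

lemma lt_log_inv {c : ℝ} (hδ : δ ∈ Ioo 0 (Real.exp (-c))) : c < Real.log δ⁻¹ := by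
  rw [Real.log_inv, lt_neg, Real.log_lt_iff_lt_exp hδ.1]
  exact hδ.2

lemma tilt_mem_Ioc (hN : 0 < N) (hδ : 0 < Real.log δ⁻¹) : tilt N δ ∈ Ioc (0 : ℝ) 1 :=
  ⟨lt_min one_pos (Real.sqrt_pos.2 (by positivity)), min_le_left _ _⟩

lemma tilt_sq (hN : 0 < N) (hδ : 0 < Real.log δ⁻¹) :
    tilt N δ ^ 2 = min 1 (Real.log δ⁻¹ / (4 * N)) := by
  have hmono : MonotoneOn (fun x : ℝ => x ^ 2) (Ici 0) := pow_left_monotoneOn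
  rw [tilt, hmono.map_min (mem_Ici.2 zero_le_one) (mem_Ici.2 (Real.sqrt_nonneg _)), one_pow,
    Real.sq_sqrt (by positivity)]

lemma eight_le_half_mul_tilt_sq (hN : 16 ≤ N) (hδ : 64 < Real.log δ⁻¹) :
    8 ≤ N / 2 * tilt N δ ^ 2 := by
  rw [tilt_sq (by linarith) (by linarith), mul_min_of_nonneg _ _ (by linarith), le_min_iff]
  refine ⟨by linarith, ?_⟩
  have hcancel : N / 2 * (Real.log δ⁻¹ / (4 * N)) = Real.log δ⁻¹ / 8 := by
    field_simp
    ring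
  linarith

lemma lt_exp_neg_tilt_sq (hN : 0 < N) (hδ0 : 0 < δ) (hδ : 64 < Real.log δ⁻¹) :
    δ < Real.exp (-(2 * tilt N δ ^ 2 * N)) / 4 := by
  have hexponent : 2 * tilt N δ ^ 2 * N ≤ Real.log δ⁻¹ / 2 :=
    calc 2 * tilt N δ ^ 2 * N ≤ 2 * (Real.log δ⁻¹ / (4 * N)) * N := by
          rw [tilt_sq hN (by linarith)]
          gcongr
          exact min_le_right _ _
      _ = Real.log δ⁻¹ / 2 := by
          field_simp
          ring
  calc δ = Real.exp (-Real.log δ⁻¹) := by rw [Real.log_inv, neg_neg, Real.exp_log hδ0]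
    _ < Real.exp (-(2 * tilt N δ ^ 2 * N) - 3) := Real.exp_lt_exp.2 (by linarith)
    _ = Real.exp (-(2 * tilt N δ ^ 2 * N)) / Real.exp 3 := Real.exp_sub _ _
    _ ≤ Real.exp (-(2 * tilt N δ ^ 2 * N)) / 4 := by
        gcongr
        linarith [Real.add_one_le_exp (3 : ℝ)]

lemma min_div_two_pow_le_tilt {d n : ℕ} (hN : 0 < N) (hNn : N ≤ 4 ^ d * n)
    (hδ : 0 < Real.log δ⁻¹) :
    min 1 ((n : ℝ) ^ (-(1 - 1 / (2 : ℝ))) * √(Real.log δ⁻¹)) / 2 ^ (d + 1) ≤ tilt N δ := by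
  have hn : (0 : ℝ) < n := pos_of_mul_pos_right (hN.trans_le hNn) (by positivity)
  have hrpow : (n : ℝ) ^ (-(1 - 1 / (2 : ℝ))) = (√n)⁻¹ := by
    rw [Real.rpow_neg hn.le, Real.sqrt_eq_rpow]
    norm_num
  have hfour : (4 : ℝ) * 4 ^ d = (2 ^ (d + 1)) ^ 2 := by
    rw [← pow_succ', ← pow_mul, mul_comm, pow_mul]
    norm_num
  refine le_min ?_ ?_
  · rw [div_le_one (by positivity)]
    exact (min_le_left _ _).trans (one_le_pow₀ one_le_two)
  · calc _ ≤ (√n)⁻¹ * √(Real.log δ⁻¹) / 2 ^ (d + 1) := by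
          rw [← hrpow]
          gcongr
          exact min_le_right _ _
      _ = √(Real.log δ⁻¹ / (4 * (4 ^ d * n))) := by
          rw [← mul_assoc, hfour, Real.sqrt_div hδ.le, Real.sqrt_mul (by positivity),
            Real.sqrt_sq (by positivity)]
          field_simp
      _ ≤ √(Real.log δ⁻¹ / (4 * N)) := by gcongr

end Tilt

theorem exists_mul_rate_le {d : ℕ} (hd : 1 ≤ d) {p : ℝ≥0∞} (hp : 1 ≤ p) :
    ∃ C : ℝ, 0 < C ∧ ∀ n : ℕ, 8 ≤ n → ∀ δ ∈ Ioo 0 (Real.exp (-64)),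
      ∀ (A : MCAlgorithm d n (sobolevSpace d p)) (e : ℝ),
        IsApproximating A.P A.run (sobolevBall d p) e δ → C * rate d 2 n δ ≤ e := by
  obtain ⟨κ, hκ, hlower⟩ := exists_error_lower_bound d hp
  refine ⟨κ / (8 * 2 ^ (d + 1)), by positivity, fun n hn δ hδ A e hA => ?_⟩
  obtain ⟨k, hk, hkt, hN⟩ := exists_grid_of_budget hd (by omega : 1 ≤ n)
  have hn' : (8 : ℝ) ≤ n := by exact_mod_cast hn
  have hlog := lt_log_inv hδ
  set N : ℝ := (k : ℝ) ^ d
  set l := tilt N δ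
  set t := (n : ℝ) ^ (1 / (d : ℝ)) with ht
  have ht0 : 0 < t := by positivity
  have hN0 : 0 < N := by positivity
  have hN16 : 16 ≤ N := by linarith [hN.1]
  have hhalf : N / 2 ≤ N - n := by linarith [hN.1]
  have hl : l ∈ Ioc (0 : ℝ) 1 := tilt_mem_Ioc hN0 (by linarith)
  have hl0 := hl.1.le
  have hbudget : 8 ≤ (N - n) * l ^ 2 :=
    (eight_le_half_mul_tilt_sq hN16 hlog).trans (by gcongr)
  refine le_trans ?_ (hlower k n hk A e δ l hA hδ.1.le hl hbudget
    (lt_exp_neg_tilt_sq hN0 hδ.1 hlog)).le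
  calc κ / (8 * 2 ^ (d + 1)) * rate d 2 n δ
      = κ / (8 * t) *
        (min 1 ((n : ℝ) ^ (-(1 - 1 / (2 : ℝ))) * √(Real.log δ⁻¹)) / 2 ^ (d + 1)) := by
        rw [rate, Real.rpow_neg (by positivity), ← ht]
        field_simp
    _ ≤ κ / (8 * t) * l := by
        gcongr
        exact min_div_two_pow_le_tilt hN0 hN.2 (by linarith)
    _ = κ * (N / 2) * l / (4 * t * N) := by
        field_simp
        ring
    _ ≤ κ * (N - n) * l / (k * N) := by
        have hnonneg : 0 ≤ N - n := by linarith
        gcongr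

theorem rate_asympLE_eProb {d : ℕ} (hd : 1 ≤ d) {p : ℝ≥0∞} (hp : 2 ≤ p) :
    AsympLE (fun n δ => ENNReal.ofReal (rate d (min p 2).toReal n δ)) (eProb d p) := by
  obtain ⟨C, hC, hlower⟩ := exists_mul_rate_le hd (one_le_two.trans hp)
  refine ⟨8, Real.exp (-64), ⟨Real.exp_pos _, Real.exp_lt_one_iff.2 (by norm_num)⟩, C⁻¹,
    inv_pos.2 hC, fun n hn δ hδ => ?_⟩
  have herror : ENNReal.ofReal (C * rate d 2 n δ) ≤ eProb d p n δ :=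
    le_iInf₂ fun e ⟨_, A, hA⟩ => ENNReal.ofReal_le_ofReal (hlower n hn δ hδ A e hA)
  simp only [min_eq_right hp, ENNReal.toReal_ofNat]
  calc ENNReal.ofReal (rate d 2 n δ)
      = ENNReal.ofReal C⁻¹ * ENNReal.ofReal (C * rate d 2 n δ) := by
        rw [← ENNReal.ofReal_mul (by positivity), inv_mul_cancel_left₀ hC.ne']
    _ ≤ ENNReal.ofReal C⁻¹ * eProb d p n δ := by gcongr

end StratSampling

theorem mainTheorem6 (d : ℕ) (hd : 1 ≤ d) (p : ℝ≥0∞) (hp : (d : ℝ≥0∞) < p)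
    (q : ℝ) (hq : q = (min p 2).toReal) :
    -- stratified sampling within the budget `n` is `(c · rate, δ)`-approximating
    StratSampling.ForSomeConstEventually (fun c n δ =>
      StratSampling.gridSize d n ^ d ≤ n ∧
      ∀ (Ω : Type*) [MeasurableSpace Ω] (P : Measure Ω) [IsProbabilityMeasure P]
        (X : (Fin d → Fin (StratSampling.gridSize d n)) → Ω → (Fin d → ℝ)),
        StratSampling.IsStratifiedSample P X →
        StratSampling.IsApproximating P (StratSampling.stratified X)
          (StratSampling.sobolevBall d p) (c * StratSampling.rate d q n δ) δ) ∧
    -- the resulting upper bound for the minimal error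
    StratSampling.AsympLE (StratSampling.eProb d p)
      (fun n δ => ENNReal.ofReal (StratSampling.rate d q n δ)) ∧
    -- the matching lower bound for `p ≥ 2`
    (2 ≤ p → StratSampling.AsympLE
      (fun n δ => ENNReal.ofReal (StratSampling.rate d q n δ)) (StratSampling.eProb d p)) := by
  subst hq
  refine ⟨?_, StratSampling.eProb_asympLE hd hp,
    fun hp2 => StratSampling.rate_asympLE_eProb hd hp2⟩
  obtain ⟨c, hc, hupper⟩ := StratSampling.exists_stratified_isApproximating hd hp
  exact ⟨1, 1 / 2, by norm_num, c, hc, fun n hn δ hδ =>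
    ⟨StratSampling.gridSize_pow_le hd n, fun Ω _ P _ X hX => hupper n hn δ hδ Ω P X hX⟩⟩
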